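/- **Theorem 2.1 (Main Properties).** Let $n,d\ge 0$ be integers, $\ell=n+d$, and let $$L=\begin{bmatrix}A&B^{\top}\\B&Q\end{bmatrix}\in\mathbb R^{\ell\times\ell}$$ be a random matrix with $A\in\mathbb R^{n\times n}$ and $Q\in\mathbb R^{d\times d}$ symmetric and $Q$ non-singular (almost surely), and $B\in\mathbb R^{d\times n}$. Assume that the entries of $A$ and $Q$ are integrable, that the entries of $B$ are square-integrable, that all products of an entry of $A$ with an entry of $B$ are integrable, and that $\mathbb E Q$ is non-singular. Write $W_{i,j}$ for the blocks of $W\in\mathbb C^{\ell\times\ell}$, $\operatorname{Im}W=\frac{1}{2i}(W-W^{*})$, $\Lambda=\operatorname{diag}(I_n,0_{d\times d})$ and $\mathbb H=\{z\in\mathbb C:\operatorname{Im}z>0\}$. Let $\mathcal S_{1,1}:\mathbb C^{\ell\times\ell}\to\mathbb C^{n\times n}$ be a linear map such that $$\mathcal S(W)=\begin{bmatrix}\mathcal S_{1,1}(W)&\mathbb E[(A-\mathbb EA)W_{1,1}(B-\mathbb EB)^{\top}]\\ \mathbb E[(B-\mathbb EB)W_{1,1}(A-\mathbb EA)]&\mathbb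 E[(B-\mathbb EB)W_{1,1}(B-\mathbb EB)^{\top}]\end{bmatrix}$$ maps positive semidefinite matrices to positive semidefinite matrices. Then there is a unique holomorphic function $M:\mathbb H\to\mathbb C^{\ell\times\ell}$ such that, for every $z\in\mathbb H$, $\operatorname{Im}M(z)\succeq0$, $\operatorname{Im}M_{1,1}(z)\succ0$ and $$(\mathbb EL-\mathcal S(M(z))-z\Lambda)M(z)=I_\ell .$$ Moreover, there is a compactly supported, positive semidefinite $\ell\times\ell$ matrix-valued Borel measure $\Omega$ on $\mathbb R$ such that $$M(z)=\begin{bmatrix}0_{n\times n}&0_{n\times d}\\0_{d\times n}&(\mathbb EQ)^{-1}\end{bmatrix}+\int_{\mathbb R}\frac{\Omega(d\lambda)}{\lambda-z}\qquad\text{for all }z\in\mathbb H,$$ and $$\Omega(\mathbb R)=\begin{bmatrix}I_n&-\mathbb E[B^{\top}](\mathbb EQ)^{-1}\\-(\mathbb EQ)^{-1}\mathbb E[B]&(\mathbb EQ)^{-1}\mathbb E[BB^{\top}](\mathbb EQ)^{-1}\end{bmatrix}.$$ -/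

import Mathlib

open MeasureTheory
open scoped ComplexStarModule ComplexOrder

namespace DEL

noncomputable section

/-- The entrywise expectation of a random matrix. -/
def expect {Ω : Type*} [MeasurableSpace Ω] (P : Measure Ω) {m k : Type*} {𝕜 : Type*} [RCLike 𝕜]
    (X : Ω → Matrix m k 𝕜) : Matrix m k 𝕜 :=
  Matrix.of fun i j => ∫ ω, X ω i j ∂P

/-- A real matrix regarded as a complex matrix. -/
def toC {m k : Type*} (X : Matrix m k ℝ) : Matrix m k ℂ :=
  X.map Complex.ofReal

/-- The open upper half of the complex plane. -/
def upperHalf : Set ℂ := {z | 0 < z.im}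

variable {n d : ℕ}

/-- Complex `ℓ × ℓ` matrices with `ℓ = n + d`, indexed so as to display the block structure. -/
abbrev BlockMat (n d : ℕ) : Type := Matrix (Fin n ⊕ Fin d) (Fin n ⊕ Fin d) ℂ

/-- The matrix `Λ = diag(I_n, 0_{d × d})`. -/
def Lam (n d : ℕ) : BlockMat n d := Matrix.fromBlocks 1 0 0 0

/-- The linearization `L = [A, Bᵀ; B, Q]`. -/
def linearization (A : Matrix (Fin n) (Fin n) ℝ) (B : Matrix (Fin d) (Fin n) ℝ)
    (Q : Matrix (Fin d) (Fin d) ℝ) : Matrix (Fin n ⊕ Fin d) (Fin n ⊕ Fin d) ℝ :=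
  Matrix.fromBlocks A B.transpose B Q

section

variable {Ω : Type*} [MeasurableSpace Ω] (P : Measure Ω)
  (A : Ω → Matrix (Fin n) (Fin n) ℝ) (B : Ω → Matrix (Fin d) (Fin n) ℝ)
  (Q : Ω → Matrix (Fin d) (Fin d) ℝ)
  (S₁₁ : BlockMat n d →ₗ[ℂ] Matrix (Fin n) (Fin n) ℂ)

/-- The superoperator `𝒮`. Its upper left block is the given map `S₁₁`; the three other blocks are
`E[(A - EA) W₁₁ (B - EB)ᵀ]`, `E[(B - EB) W₁₁ (A - EA)]` and `E[(B - EB) W₁₁ (B - EB)ᵀ]`. -/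
def superop (W : BlockMat n d) : BlockMat n d :=
  Matrix.fromBlocks
    (S₁₁ W)
    (expect P fun ω =>
      toC (A ω - expect P A) * W.toBlocks₁₁ * toC (B ω - expect P B).transpose)
    (expect P fun ω =>
      toC (B ω - expect P B) * W.toBlocks₁₁ * toC (A ω - expect P A))
    (expect P fun ω =>
      toC (B ω - expect P B) * W.toBlocks₁₁ * toC (B ω - expect P B).transpose)

/-- The admissible set `𝒜` of matrices: `Im W ⪰ 0` and `Im W₁₁ ≻ 0`, where
`Im W = (W - W*) / (2i)`. -/
def admissibleSet (n d : ℕ) : Set (BlockMat n d) :=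
  {W | (ℑ W : BlockMat n d).PosSemidef ∧
    (ℑ W.toBlocks₁₁ : Matrix (Fin n) (Fin n) ℂ).PosDef}

/-- `M` is a solution of the Dyson equation in the admissible class: it is holomorphic on the upper
half-plane, takes values in the admissible set there, and satisfies
`(E L - 𝒮(M(z)) - z Λ) M(z) = I` for every `z` in the upper half-plane. -/
structure IsSolution (M : ℂ → BlockMat n d) : Prop where
  holomorphic : ∀ i j, DifferentiableOn ℂ (fun z => M z i j) upperHalf
  admissible : ∀ z ∈ upperHalf, M z ∈ admissibleSet n d
  dyson : ∀ z ∈ upperHalf,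
    (toC (expect P fun ω => linearization (A ω) (B ω) (Q ω)) - superop P A B S₁₁ (M z)
      - z • Lam n d) * M z = 1

/-- The block matrix `diag(0_{n × n}, (E Q)⁻¹)`. -/
def MInfty (n : ℕ) : BlockMat n d :=
  Matrix.fromBlocks 0 0 0 (toC (expect P Q)⁻¹)

/-- The claimed total mass
`[I, -E[Bᵀ] (EQ)⁻¹; -(EQ)⁻¹ E[B], (EQ)⁻¹ E[B Bᵀ] (EQ)⁻¹]` of the representing measure. -/
def totalMass : BlockMat n d :=
  toC (Matrix.fromBlocks
    1
    (-((expect P B).transpose * (expect P Q)⁻¹))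
    (-((expect P Q)⁻¹ * expect P B))
    ((expect P Q)⁻¹ * (expect P fun ω => B ω * (B ω).transpose) * (expect P Q)⁻¹))

end

section

variable {ι : Type*} (Ξ : VectorMeasure ℝ (Matrix ι ι ℂ))

/-- The `(i, j)` entry of a matrix-valued measure on the real line, a complex measure. -/
def entry (i j : ι) : ComplexMeasure ℝ :=
  Ξ.mapRange (Matrix.entryAddMonoidHom ℂ i j) (continuous_id.matrix_elem i j)

theorem entry_apply (i j : ι) (s : Set ℝ) : entry Ξ i j s = Ξ s i j := rfl

/-- The measure takes positive semidefinite values. -/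
def IsPSDMeasure : Prop :=
  ∀ s : Set ℝ, MeasurableSet s → (Ξ s).PosSemidef

/-- The measure is carried by a compact set. -/
def IsCompactlySupported : Prop :=
  ∃ K : Set ℝ, IsCompact K ∧ ∀ s : Set ℝ, MeasurableSet s → Disjoint s K → Ξ s = 0

/-- `T = ∫ f dΞ`: the function `f` is integrable with respect to every entry of `Ξ`, and `T` is the
matrix of the integrals of `f` against the entries of `Ξ`. -/
def HasMatIntegral (f : ℝ → ℂ) (T : Matrix ι ι ℂ) : Prop :=
  ∀ i j, (entry Ξ i j).Integrable f ∧
    T i j = (entry Ξ i j).integral f (ContinuousLinearMap.mul ℝ ℂ)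

end

end

end DEL

/-! Write `H` for `E L`, `J` for `diag(0, (E Q)⁻¹)`, `p` for `Λ` and `S` for the superoperator. The
solution is the limit of the iteration `(H - S M_k - z p) M_{k+1} = 1`.

Positivity: every iterate is `J` plus the Stieltjes transform of a finitely supported positive
semidefinite matrix measure. Indeed `S` of such a transform has the form `Cᴴ (D - z)⁻¹ C` with `D`
real diagonal, and a Schur complement turns the next iterate into `J + Vᴴ (T - z)⁻¹ V` with `T`
Hermitian; the spectral theorem supplies the new atoms (`exists_atomic_resolvent`,
`AtomicMeasure.exists_step`). The mass `Vᴴ V` depends on the previous measure only through the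
corner of its mass, which is always `p`, so all iterates share the mass `dysonMass`.

Convergence: near infinity the iterates are close to `J`, not to `0`, so `S M` is not small there.
But the lower row and right column of `S M` see only the corner `p M p`, which is small for large
`z`. In the norm `τ‖pΔp‖ + ‖Δ‖` the iteration therefore contracts for large `z`
(`DysonData.contraction`). Boundedness near infinity confines all atoms to one segment. Convergence
far up the imaginary axis gives convergence of the moments and, by Weierstrass, of all integrals of
continuous functions. The limit is a positive functional, hence a matrix measure by Riesz-Markov and
polarization, and its transform solves the equation off the real axis.

Uniqueness: `Im M ⪰ 0` forces the corner to be `O(1 / Im z)`, so the same contraction identifies any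
two solutions far up, and the identity theorem does the rest. -/

/-! ### Vector measures that are multiples of a finite measure -/

section ComplexMultiple

variable {X : Type*} [MeasurableSpace X]

/-- The vector measure `s ↦ μ(s) • c` attached to a finite measure `μ` and a vector `c`. -/
noncomputable def smulVec {V : Type*} [AddCommGroup V] [Module ℝ V] [TopologicalSpace V]
    [ContinuousSMul ℝ V] (μ : Measure X) [IsFiniteMeasure μ] (c : V) : VectorMeasure X V :=
  μ.toSignedMeasure.mapRange ((LinearMap.toSpanSingleton ℝ V c).toAddMonoidHom)
    (by
      change Continuous fun r : ℝ => r • c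
      fun_prop)

theorem smulVec_apply {V : Type*} [AddCommGroup V] [Module ℝ V] [TopologicalSpace V]
    [ContinuousSMul ℝ V] (μ : Measure X) [IsFiniteMeasure μ] (c : V) {s : Set X}
    (hs : MeasurableSet s) : smulVec μ c s = μ.real s • c := by
  change (μ.toSignedMeasure s) • c = _
  rw [Measure.toSignedMeasure_apply_measurable hs]

variable (μ : Measure X) [IsFiniteMeasure μ] (c : ℂ)

theorem variation_smulVec_le : (smulVec μ c).variation ≤ ‖c‖₊ • μ := by
  apply VectorMeasure.variation_le_of_forall_enorm_le
  intro s hs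
  rw [smulVec_apply μ c hs, enorm_smul, Measure.smul_apply, mul_comm, ENNReal.smul_def, smul_eq_mul,
    enorm_eq_nnnorm c, Real.enorm_of_nonneg measureReal_nonneg, ofReal_measureReal]

theorem smulVec_integrable {f : X → ℂ} (hf : Integrable f μ) : (smulVec μ c).Integrable f :=
  Integrable.mono_measure (hf.smul_measure_nnreal (c := ‖c‖₊)) (variation_smulVec_le μ c)

/-- Both sides agree on indicators and are continuous on `L¹(μ)`: the variation is at most `‖c‖ μ`,
so `L¹(μ)` maps continuously to `L¹` of the variation. -/
theorem integral_smulVec {f : X → ℂ} (hf : Integrable f μ) :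
    (smulVec μ c).integral f (ContinuousLinearMap.mul ℝ ℂ) = c * ∫ x, f x ∂μ := by
  have hac : (smulVec μ c).variation ≪ μ :=
    Measure.absolutelyContinuous_of_le_smul (variation_smulVec_le μ c)
  refine Integrable.induction (fun f : X → ℂ => (smulVec μ c).integral f
    (ContinuousLinearMap.mul ℝ ℂ) = c * ∫ x, f x ∂μ) ?_ ?_ ?_ ?_ hf
  · intro a s hs hμ
    have hfin : (smulVec μ c).variation s ≠ ⊤ :=
      ((variation_smulVec_le μ c s).trans_lt (measure_lt_top _ s)).ne
    rw [VectorMeasure.integral_eq_setToFun, setToFun_indicator_const _ hs hfin, integral_indicator hs]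
    change a * (smulVec μ c s) = _
    rw [smulVec_apply μ c hs]
    simp [Complex.real_smul, mul_comm, mul_left_comm]
  · intro f g hd hf hg h1 h2
    rw [VectorMeasure.integral_add (smulVec_integrable μ c hf) (smulVec_integrable μ c hg), h1, h2,
      integral_add' hf hg, mul_add]
  · refine isClosed_eq ?_ (continuous_const.mul continuous_integral)
    have hT := dominatedFinMeasAdditive_cbmApplyMeasure (smulVec μ c) (ContinuousLinearMap.mul ℝ ℂ)
    have key := continuous_L1_toL1 (G := ℂ) (μ := μ) (μ' := (smulVec μ c).variation) (‖c‖₊ : ENNReal) (by simp)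
      (variation_smulVec_le μ c)
    refine ((continuous_setToFun hT).comp key).congr fun f => ?_
    exact setToFun_congr_ae hT (Integrable.coeFn_toL1 _)
  · intro f g hfg hf h
    rw [← integral_congr_ae hfg, ← h]
    exact VectorMeasure.integral_congr_ae (hac.ae_eq hfg.symm)

end ComplexMultiple

/-! ### Matrices and their quadratic forms -/

section QuadraticForm

open Matrix

variable {ι : Type*} [Fintype ι] [DecidableEq ι]

/-- The vectors `e_a + I ^ k • e_b` that recover the entries of a matrix from its quadratic form. -/
noncomputable def polVec (a b : ι) (k : Fin 4) : ι → ℂ :=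
  Pi.single a 1 + Complex.I ^ (k : ℕ) • Pi.single b 1

/-- With `c = I ^ k` the form equals `A a a + c * A a b + star c * A b a + A b b`; averaging against
`(-I) ^ k` over the fourth roots of unity keeps only the coefficient of `c`. -/
theorem polarization_entry (A : Matrix ι ι ℂ) (a b : ι) :
    A a b = ∑ k : Fin 4, (-Complex.I) ^ (k : ℕ) / 4 *
      (star (polVec a b k) ⬝ᵥ A *ᵥ polVec a b k) := by
  have key : ∀ c : ℂ, star (Pi.single a 1 + c • Pi.single b 1 : ι → ℂ) ⬝ᵥ
      A *ᵥ (Pi.single a 1 + c • Pi.single b 1) =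
      A a a + c * A a b + star c * A b a + star c * c * A b b := by
    intro c
    simp only [star_add, star_smul, Matrix.mulVec_add, Matrix.mulVec_smul, add_dotProduct,
      dotProduct_add, smul_dotProduct, dotProduct_smul, Pi.star_single, star_one,
      Matrix.mulVec_single_one, single_one_dotProduct, Matrix.col_apply, smul_eq_mul]
    ring
  simp only [polVec, key, Fin.sum_univ_four]
  simp [pow_succ]
  ring_nf
  simp [Complex.I_sq]
  ring

theorem posSemidef_of_forall_real (A : Matrix ι ι ℂ)
    (h : ∀ v : ι → ℂ, 0 ≤ star v ⬝ᵥ A *ᵥ v) : A.PosSemidef := by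
  refine PosSemidef.of_dotProduct_mulVec_nonneg ?_ h
  have hq : ∀ v : ι → ℂ, star v ⬝ᵥ Aᴴ *ᵥ v = star v ⬝ᵥ A *ᵥ v := by
    intro v
    have h1 : star (star v ⬝ᵥ A *ᵥ v) = star v ⬝ᵥ Aᴴ *ᵥ v := by
      rw [Matrix.star_dotProduct, Matrix.star_mulVec, star_star, Matrix.dotProduct_mulVec]
    rw [← h1]
    exact (IsSelfAdjoint.of_nonneg (h v)).star_eq
  ext a b
  rw [polarization_entry Aᴴ, polarization_entry A]
  simp only [hq]

end QuadraticForm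

/-! ### Positive matrix-valued functionals on a segment and their representing measures -/

section Riesz

open Set

/-- Moving the terms with negative `α c` to the other side turns the relation into an equality of
two finite positive measures, and these are determined by integrals of bounded continuous functions.
-/
theorem sum_measureReal_eq_zero_of_integral {γ : Type*} [Fintype γ] (μ : γ → Measure ℝ)
    [∀ c, IsFiniteMeasure (μ c)] (α : γ → ℝ)
    (h : ∀ f : BoundedContinuousFunction ℝ ℝ, ∑ c, α c * ∫ x, f x ∂(μ c) = 0)
    (s : Set ℝ) : ∑ c, α c * (μ c).real s = 0 := by
  have key : (∑ c, (α c).toNNReal • μ c) = ∑ c, (-α c).toNNReal • μ c := by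
    apply ext_of_forall_integral_eq_of_IsFiniteMeasure
    intro f
    have hi : ∀ c (r : NNReal), Integrable f (r • μ c) := fun c r => f.integrable _
    rw [integral_finsetSum_measure fun c _ => hi c _, integral_finsetSum_measure fun c _ => hi c _,
      ← sub_eq_zero, ← Finset.sum_sub_distrib, ← h f]
    refine Finset.sum_congr rfl fun c _ => ?_
    rw [integral_smul_nnreal_measure, integral_smul_nnreal_measure]
    simp only [NNReal.smul_def, Real.coe_toNNReal', smul_eq_mul, ← sub_mul]
    congr 1
    rcases le_total 0 (α c) with h0 | h0 <;> simp [h0]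
  have hs := congrArg (fun ν : Measure ℝ => ν.real s) key
  have hsum : ∀ r : γ → NNReal, (∑ c, r c • μ c).real s = ∑ c, (r c : ℝ) * (μ c).real s := by
    intro r
    rw [measureReal_def, Measure.finsetSum_apply, ENNReal.toReal_sum fun c _ => measure_ne_top _ _]
    exact Finset.sum_congr rfl fun c _ => measureReal_nnreal_smul_apply _
  simp only [hsum, Real.coe_toNNReal'] at hs
  rw [← sub_eq_zero, ← Finset.sum_sub_distrib] at hs
  rw [← hs]
  refine Finset.sum_congr rfl fun c _ => ?_
  rw [← sub_mul]
  congr 1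
  rcases le_total 0 (α c) with h0 | h0 <;> simp [h0]

theorem sum_measureReal_eq_zero_of_integral_complex {γ : Type*} [Fintype γ] (μ : γ → Measure ℝ)
    [∀ c, IsFiniteMeasure (μ c)] (α : γ → ℂ)
    (h : ∀ f : BoundedContinuousFunction ℝ ℝ, ∑ c, α c * ((∫ x, f x ∂(μ c) : ℝ) : ℂ) = 0)
    (s : Set ℝ) : ∑ c, α c * ((μ c).real s : ℂ) = 0 := by
  apply Complex.ext
  · have := sum_measureReal_eq_zero_of_integral μ (fun c => (α c).re) (fun f => by
      simpa using congrArg Complex.re (h f)) s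
    simpa using this
  · have := sum_measureReal_eq_zero_of_integral μ (fun c => (α c).im) (fun f => by
      simpa using congrArg Complex.im (h f)) s
    simpa using this

variable {a b : ℝ}

/-- The restriction of a continuous function on the line to a segment. -/
def restrictIcc (a b : ℝ) (f : C(ℝ, ℝ)) : C(Icc a b, ℝ) := f.restrict (Icc a b)

theorem exists_measure_of_positive (ψ : C(Icc a b, ℝ) →ₗ[ℝ] ℝ)
    (hψ : ∀ f, (∀ x, 0 ≤ f x) → 0 ≤ ψ f) :
    ∃ μ : Measure ℝ, IsFiniteMeasure μ ∧ μ (Icc a b)ᶜ = 0 ∧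
      ∀ f : C(ℝ, ℝ), ∫ x, f x ∂μ = ψ (restrictIcc a b f) := by
  let φ : CompactlySupportedContinuousMap (Icc a b) ℝ →ₚ[ℝ] ℝ :=
    PositiveLinearMap.mk₀
      { toFun := fun f => ψ f.toContinuousMap
        map_add' := fun f g => ψ.map_add _ _
        map_smul' := fun c f => ψ.map_smul c _ } (fun f hf => hψ _ hf)
  let ν := RealRMK.rieszMeasure φ
  refine ⟨ν.map Subtype.val, inferInstance, ?_, fun f => ?_⟩
  · rw [Measure.map_apply measurable_subtype_coe measurableSet_Icc.compl]
    simp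
  · rw [integral_map measurable_subtype_coe.aemeasurable
      f.continuous.aestronglyMeasurable]
    exact RealRMK.integral_rieszMeasure φ
      ⟨restrictIcc a b f, HasCompactSupport.of_compactSpace _⟩

section Matrix

open Matrix DEL

variable {ι : Type*} [Fintype ι] [DecidableEq ι]

/-- Riesz-Markov gives a scalar measure `μ v` for each form `f ↦ v* L(f) v`. The matrix measure is
assembled from the finitely many polarization vectors. Its positivity needs all `v`, and follows
once its quadratic form at `v` is recognized as `μ v`. -/
theorem exists_vectorMeasure_of_positive (L : C(Icc a b, ℝ) →ₗ[ℝ] Matrix ι ι ℂ)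
    (hL : ∀ f, (∀ x, 0 ≤ f x) → (L f).PosSemidef) :
    ∃ Ξ : VectorMeasure ℝ (Matrix ι ι ℂ), IsPSDMeasure Ξ ∧ IsCompactlySupported Ξ ∧
      Ξ univ = L 1 ∧ ∀ f g : C(ℝ, ℝ), HasMatIntegral Ξ (fun x => (f x : ℂ) + g x * Complex.I)
        (L (restrictIcc a b f) + Complex.I • L (restrictIcc a b g)) := by
  let ψ : (ι → ℂ) → C(Icc a b, ℝ) →ₗ[ℝ] ℝ := fun v =>
    { toFun := fun f => (star v ⬝ᵥ L f *ᵥ v).re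
      map_add' := fun f g => by simp [Matrix.add_mulVec]
      map_smul' := fun c f => by simp [Matrix.smul_mulVec] }
  have hreal : ∀ v f, star v ⬝ᵥ L f *ᵥ v = (ψ v f : ℂ) := by
    intro v f
    have h1 : ∀ g, (∀ x, 0 ≤ g x) → (star v ⬝ᵥ L g *ᵥ v).im = 0 := fun g hg =>
      (Complex.nonneg_iff.1 ((hL g hg).dotProduct_mulVec_nonneg v)).2.symm
    -- A difference of nonnegative functions, on each of which the form is real.
    have h2 : f = (f + ‖f‖ • 1) - ‖f‖ • 1 := by simp
    have h3 : (star v ⬝ᵥ L f *ᵥ v).im = 0 := by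
      rw [h2, map_sub, Matrix.sub_mulVec, dotProduct_sub, Complex.sub_im, h1, h1, sub_zero]
      · intro x; simp
      · intro x
        have := neg_le_of_abs_le (f.norm_coe_le_norm x)
        simp; linarith
    exact Complex.ext (by simp [ψ]) (by simp [h3])
  have hψ : ∀ v f, (∀ x, 0 ≤ f x) → 0 ≤ ψ v f := fun v f hf =>
    (Complex.nonneg_iff.1 ((hL f hf).dotProduct_mulVec_nonneg v)).1
  choose μ hfin hsupp hint using fun v => exists_measure_of_positive (ψ v) (hψ v)
  let X : ι × ι × Fin 4 → Matrix ι ι ℂ := fun c =>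
    Matrix.single c.1 c.2.1 ((-Complex.I) ^ (c.2.2 : ℕ) / 4)
  let w : ι × ι × Fin 4 → ι → ℂ := fun c => polVec c.1 c.2.1 c.2.2
  have hpol : ∀ A : Matrix ι ι ℂ, A = ∑ c, (star (w c) ⬝ᵥ A *ᵥ w c) • X c := by
    intro A
    ext i j
    rw [polarization_entry A i j, Matrix.sum_apply]
    simp only [X, w, Fintype.sum_prod_type, Matrix.smul_apply, Matrix.single_apply, smul_eq_mul]
    rw [Finset.sum_eq_single i, Finset.sum_eq_single j]
    · simp [mul_comm]
    · intro j' _ hj; simp [hj]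
    · simp
    · intro i' _ hi; simp [hi]
    · simp
  let Ξ : VectorMeasure ℝ (Matrix ι ι ℂ) := ∑ c, smulVec (μ (w c)) (X c)
  have hΞ : ∀ s, MeasurableSet s → Ξ s = ∑ c, ((μ (w c)).real s : ℂ) • X c := by
    intro s hs
    simp only [Ξ, FunLike.coe_sum, Finset.sum_apply]
    refine Finset.sum_congr rfl fun c _ => ?_
    rw [smulVec_apply _ _ hs]
    ext i j
    simp
  have hquad : ∀ s, MeasurableSet s → ∀ v, star v ⬝ᵥ Ξ s *ᵥ v = ((μ v).real s : ℂ) := by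
    intro s hs v
    -- The index `none` carries `μ v` with coefficient `-1`. The relation holds for integrals
    -- because `L f` is recovered by polarization, and so it passes to measures of sets.
    have h := sum_measureReal_eq_zero_of_integral_complex
      (fun o : Option (ι × ι × Fin 4) => μ (o.elim v w))
      (fun o => o.elim (-1) fun c => star v ⬝ᵥ X c *ᵥ v) (fun f => by
        have h1 : ∀ u, ∫ x, f x ∂(μ u) = ψ u (restrictIcc a b f.toContinuousMap) :=
          fun u => hint u f.toContinuousMap
        simp only [h1, ← hreal, Fintype.sum_option, Option.elim]
        rw [neg_one_mul, neg_add_eq_zero]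
        conv_lhs => rw [hpol (L _)]
        simp only [Matrix.sum_mulVec, dotProduct_sum, Matrix.smul_mulVec, dotProduct_smul,
          smul_eq_mul, mul_comm]) s
    simp only [Fintype.sum_option, Option.elim, neg_one_mul, neg_add_eq_zero] at h
    rw [h, hΞ s hs]
    simp only [Matrix.sum_mulVec, dotProduct_sum, Matrix.smul_mulVec, dotProduct_smul,
      smul_eq_mul, mul_comm]
  have hmean : ∀ v, (μ v).real univ = ψ v 1 := by
    intro v
    have : ∫ x, (1 : C(ℝ, ℝ)) x ∂(μ v) = ψ v 1 := hint v 1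
    simpa using this
  have hintegrable : ∀ v (f : C(ℝ, ℝ)), Integrable (fun x => (f x : ℂ)) (μ v) := by
    intro v f
    have h1 : (μ v).restrict (Icc a b) = μ v :=
      Measure.restrict_eq_self_of_ae_mem (by
        rw [ae_iff]; exact hsupp v)
    rw [← h1]
    exact Integrable.ofReal (f.continuous.integrableOn_Icc)
  refine ⟨Ξ, fun s hs => posSemidef_of_forall_real _ fun v => ?_, ⟨Icc a b, isCompact_Icc, ?_⟩, ?_, ?_⟩
  · rw [hquad s hs v]
    exact_mod_cast measureReal_nonneg
  · intro s hs hd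
    rw [hΞ s hs]
    refine Finset.sum_eq_zero fun c _ => ?_
    have : μ (w c) s = 0 := measure_mono_null hd.subset_compl_right (hsupp _)
    simp [measureReal_def, this]
  · rw [hΞ univ MeasurableSet.univ, hpol (L 1)]
    refine Finset.sum_congr rfl fun c _ => ?_
    rw [hreal, hmean]
  · intro f g i j
    have hentry : entry Ξ i j = ∑ c, smulVec (μ (w c)) (X c i j) := by
      ext s hs
      rw [entry_apply, hΞ s hs]
      simp only [FunLike.coe_sum, Finset.sum_apply, Matrix.sum_apply]
      refine Finset.sum_congr rfl fun c _ => ?_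
      rw [smulVec_apply _ _ hs]
      simp
    have hfg : ∀ v, Integrable (fun x => (f x : ℂ) + g x * Complex.I) (μ v) := fun v =>
      (hintegrable v f).add ((hintegrable v g).mul_const _)
    rw [hentry]
    refine ⟨VectorMeasure.Integrable.finsetSum_vectorMeasure fun c _ =>
      smulVec_integrable _ _ (hfg _), ?_⟩
    rw [VectorMeasure.integral_finsetSum_vectorMeasure fun c _ => smulVec_integrable _ _ (hfg _)]
    rw [hpol (L (restrictIcc a b f)), hpol (L (restrictIcc a b g)), Matrix.add_apply,
      Matrix.smul_apply, Matrix.sum_apply, Matrix.sum_apply, Finset.smul_sum,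
      ← Finset.sum_add_distrib]
    refine Finset.sum_congr rfl fun c _ => ?_
    rw [integral_smulVec _ _ (hfg _), integral_add (hintegrable _ f)
      ((hintegrable _ g).mul_const _), integral_mul_const, integral_complex_ofReal,
      integral_complex_ofReal, hint, hint, hreal, hreal]
    simp only [Matrix.smul_apply, smul_eq_mul]
    ring

end Matrix

end Riesz

/-! ### A Hermitian realization of the inverse, by Schur complements -/

section Realization

open Matrix

variable {m ℓ κ : Type*} [Fintype ℓ] [DecidableEq ℓ]

/-- The Hermitian matrix whose resolvent, compressed by `realizationVec`, is the inverse of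
`H - z eᴴ e - Cᴴ (D - z)⁻¹ C`. -/
def realizationOp [DecidableEq κ] (e : Matrix m ℓ ℂ) (H J : Matrix ℓ ℓ ℂ) (C : Matrix κ ℓ ℂ) (D : κ → ℝ) :
    Matrix (m ⊕ κ) (m ⊕ κ) ℂ :=
  fromBlocks (e * (H - H * J * H) * eᴴ) (e * (1 - H * J) * Cᴴ) (C * (1 - J * H) * eᴴ)
    (diagonal (fun k => (D k : ℂ)) - C * J * Cᴴ)

/-- The compression that accompanies `realizationOp`. -/
def realizationVec (e : Matrix m ℓ ℂ) (H J : Matrix ℓ ℓ ℂ) (C : Matrix κ ℓ ℂ) :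
    Matrix (m ⊕ κ) ℓ ℂ :=
  fromRows (e * (1 - H * J)) (-(C * J))

variable {e : Matrix m ℓ ℂ} {H J : Matrix ℓ ℓ ℂ} {C : Matrix κ ℓ ℂ} {D : κ → ℝ}

theorem realizationOp_isHermitian [DecidableEq κ] (hH : H.IsHermitian) (hJ : J.IsHermitian) :
    (realizationOp e H J C D).IsHermitian := by
  unfold realizationOp
  rw [isHermitian_fromBlocks_iff]
  refine ⟨?_, ?_, ?_, ?_⟩
  · simp [IsHermitian, conjTranspose_mul, hH.eq, hJ.eq, Matrix.mul_assoc]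
  · simp [conjTranspose_mul, hH.eq, hJ.eq, Matrix.mul_assoc]
  · simp [conjTranspose_mul, hH.eq, hJ.eq, Matrix.mul_assoc]
  · refine IsHermitian.sub (isHermitian_diagonal_iff.2 fun k => ?_) ?_
    · simp [IsSelfAdjoint]
    · simp [IsHermitian, conjTranspose_mul, hJ.eq, Matrix.mul_assoc]

theorem realizationVec_gram [Fintype m] [Fintype κ] (hH : H.IsHermitian) (hJ : J.IsHermitian) :
    (realizationVec e H J C)ᴴ * realizationVec e H J C =
      (1 - J * H) * (eᴴ * e) * (1 - H * J) + J * (Cᴴ * C) * J := by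
  simp [realizationVec, conjTranspose_fromRows_eq_fromCols_conjTranspose, fromCols_mul_fromRows,
    conjTranspose_mul, hH.eq, hJ.eq, Matrix.mul_assoc]

/-- For a solution `G`, set `y = e G` and `w = -(D - z)⁻¹ C G`. Eliminating the part of `G` outside
the range of `eᴴ e`, where `J` inverts `H`, leaves a linear system for `(y, w)` that involves `z`
only through `-z`. The proof runs this backwards. -/
theorem realization_mul_eq_one [Fintype m] [DecidableEq m] [Fintype κ] [DecidableEq κ]
    (hH : H.IsHermitian) (hJ : J.IsHermitian) (he : e * eᴴ = 1)
    (heJ : e * J = 0) (hHJ : (1 - eᴴ * e) * (H * J) = 1 - eᴴ * e) {z : ℂ} (hz : z.im ≠ 0)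
    {Y : Matrix (m ⊕ κ) ℓ ℂ}
    (hY : realizationOp e H J C D * Y - z • Y = realizationVec e H J C) :
    (H - z • (eᴴ * e) - Cᴴ * diagonal (fun k => ((D k : ℂ) - z)⁻¹) * C) *
      (J + (realizationVec e H J C)ᴴ * Y) = 1 := by
  obtain ⟨y, w, rfl⟩ : ∃ y w, Y = fromRows y w := ⟨Y.toRows₁, Y.toRows₂, (fromRows_toRows Y).symm⟩
  have hDz : ∀ k, (D k : ℂ) - z ≠ 0 := fun k h => hz (by
    have := congrArg Complex.im h
    simpa using this)
  rw [realizationOp, realizationVec, fromBlocks_mul_fromRows] at hY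
  have hY1 : e * (H - H * J * H) * eᴴ * y + e * (1 - H * J) * Cᴴ * w - z • y =
      e * (1 - H * J) := by
    ext i j; exact congrFun (congrFun hY (Sum.inl i)) j
  have hY2 : C * (1 - J * H) * eᴴ * y + (diagonal (fun k => (D k : ℂ)) - C * J * Cᴴ) * w - z • w =
      -(C * J) := by
    ext i j; exact congrFun (congrFun hY (Sum.inr i)) j
  have hV : (realizationVec e H J C)ᴴ * fromRows y w =
      (1 - J * H) * (eᴴ * y) - J * (Cᴴ * w) := by
    simp [realizationVec, conjTranspose_fromRows_eq_fromCols_conjTranspose, fromCols_mul_fromRows,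
      conjTranspose_mul, hH.eq, hJ.eq, Matrix.mul_assoc, sub_eq_add_neg]
  rw [hV]
  set G := J + ((1 - J * H) * (eᴴ * y) - J * (Cᴴ * w)) with hG
  -- The second row of the system says `C G = -(D - z) w`.
  have hw : diagonal (fun k => ((D k : ℂ) - z)⁻¹) * (C * G) = -w := by
    have h1 : C * G = -(diagonal (fun k => (D k : ℂ) - z) * w) := by
      have h2 : diagonal (fun k => (D k : ℂ) - z) * w =
          diagonal (fun k => (D k : ℂ)) * w - z • w := by
        ext i j; simp [sub_mul]
      rw [h2, hG]
      simp only [Matrix.mul_add, Matrix.mul_sub, Matrix.sub_mul, Matrix.mul_assoc,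
        Matrix.mul_one, Matrix.one_mul] at hY2 ⊢
      rw [← sub_eq_zero] at hY2 ⊢
      rw [← hY2]
      abel
    rw [h1, Matrix.mul_neg, ← Matrix.mul_assoc, diagonal_mul_diagonal]
    simp [hDz]
  set u := eᴴ * y with hu
  set s := Cᴴ * w with hs
  set p := eᴴ * e with hp
  have hpu : p * u = u := by
    rw [hp, hu, Matrix.mul_assoc, ← Matrix.mul_assoc e, he, Matrix.one_mul]
  have hpJ : p * J = 0 := by rw [hp, Matrix.mul_assoc, heJ, Matrix.mul_zero]
  have hpX : p * (1 - H * J) = 1 - H * J := by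
    have : (1 - p) * (1 - H * J) = 0 := by rw [mul_sub, mul_one, hHJ, sub_self]
    rwa [sub_mul, one_mul, sub_eq_zero, eq_comm] at this
  -- The first row, lifted by `eᴴ`; `hpX` removes the projection this produces.
  have h1 : (H - H * J * H) * u + (1 - H * J) * s - z • u = 1 - H * J := by
    have h2 : eᴴ * (e * (H - H * J * H) * eᴴ * y) + eᴴ * (e * (1 - H * J) * Cᴴ * w) -
        z • (eᴴ * y) = eᴴ * (e * (1 - H * J)) := by
      rw [← Matrix.mul_smul, ← Matrix.mul_add, ← Matrix.mul_sub, hY1]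
    have h3 : eᴴ * (e * (H - H * J * H) * eᴴ * y) = p * (1 - H * J) * H * u := by
      simp only [hp, hu, Matrix.mul_assoc, Matrix.sub_mul, Matrix.one_mul]
    have h4 : eᴴ * (e * (1 - H * J) * Cᴴ * w) = p * (1 - H * J) * s := by
      simp only [hp, hs, Matrix.mul_assoc]
    have h5 : eᴴ * (e * (1 - H * J)) = p * (1 - H * J) := by
      simp only [hp, Matrix.mul_assoc]
    rw [h3, h4, h5, hpX, sub_mul, one_mul] at h2
    exact h2
  have hpG : p * G = u := by
    have : p * G = p * J + (p * u - p * J * H * u - p * J * s) := by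
      rw [hG]; noncomm_ring
    rw [this, hpJ, hpu]; simp
  have hHG : H * G = H * J + ((H - H * J * H) * u) - H * J * s := by
    rw [hG]; noncomm_ring
  have hHu : (H - H * J * H) * u = 1 - H * J - (1 - H * J) * s + z • u := by
    rw [sub_eq_iff_eq_add] at h1
    rw [← eq_sub_iff_add_eq] at h1
    rw [h1]; abel
  have hCG : Cᴴ * diagonal (fun k => ((D k : ℂ) - z)⁻¹) * C * G = -s := by
    rw [Matrix.mul_assoc, Matrix.mul_assoc, hw, Matrix.mul_neg, ← hs]
  rw [Matrix.sub_mul, hCG, Matrix.sub_mul, Matrix.smul_mul, hpG, hHG, hHu]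
  noncomm_ring

end Realization

/-! ### Atomic matrix measures and one step of the iteration -/

section Atomic

open Matrix

theorem Matrix.PosSemidef.exists_conjTranspose_mul_self {ℓ : Type*} [Fintype ℓ] [DecidableEq ℓ]
    {A : Matrix ℓ ℓ ℂ} (hA : A.PosSemidef) : ∃ C : Matrix ℓ ℓ ℂ, A = Cᴴ * C := by
  open scoped MatrixOrder in
  exact CStarAlgebra.nonneg_iff_eq_star_mul_self.mp hA.nonneg

/-- A finitely supported measure on the real line with positive semidefinite matrix weights. -/
structure AtomicMeasure (ℓ : Type*) where
  /-- the atoms -/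
  idx : Type
  /-- there are finitely many of them -/
  [fin : Fintype idx]
  /-- the positions of the atoms -/
  pos : idx → ℝ
  /-- the weights of the atoms -/
  wt : idx → Matrix ℓ ℓ ℂ
  psd : ∀ j, (wt j).PosSemidef

attribute [instance] AtomicMeasure.fin

variable {ℓ : Type} [Fintype ℓ] [DecidableEq ℓ]

/-- The integral of a function against an atomic matrix measure. -/
def AtomicMeasure.integral {ℓ : Type*} (μ : AtomicMeasure ℓ) (f : ℝ → ℂ) : Matrix ℓ ℓ ℂ :=
  ∑ j, f (μ.pos j) • μ.wt j

/-- Diagonalize the Hermitian realization `T`. Its eigenvalues are the atoms, and each weight is the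
rank one matrix of the compressed eigenvector, so the transform is `Vᴴ (T - z)⁻¹ V` and the mass is
the Gram matrix `Vᴴ V`. -/
theorem exists_atomic_resolvent {m κ : Type} [Fintype m] [DecidableEq m] [Fintype κ]
    [DecidableEq κ] {e : Matrix m ℓ ℂ} {H J : Matrix ℓ ℓ ℂ} (C : Matrix κ ℓ ℂ) (D : κ → ℝ)
    (hH : H.IsHermitian) (hJ : J.IsHermitian) (he : e * eᴴ = 1)
    (heJ : e * J = 0) (hHJ : (1 - eᴴ * e) * (H * J) = 1 - eᴴ * e) :
    ∃ ν : AtomicMeasure ℓ,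
      ν.integral 1 = (1 - J * H) * (eᴴ * e) * (1 - H * J) + J * (Cᴴ * C) * J ∧
      ∀ z : ℂ, z.im ≠ 0 →
        (H - z • (eᴴ * e) - Cᴴ * diagonal (fun k => ((D k : ℂ) - z)⁻¹) * C) *
          (J + ν.integral fun x => ((x : ℂ) - z)⁻¹) = 1 := by
  set T := realizationOp e H J C D with hTdef
  set V := realizationVec e H J C with hVdef
  have hT : T.IsHermitian := realizationOp_isHermitian hH hJ
  let U : Matrix (m ⊕ κ) (m ⊕ κ) ℂ := hT.eigenvectorUnitary
  let t := hT.eigenvalues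
  have hUU : U * Uᴴ = 1 := Unitary.coe_mul_star_self hT.eigenvectorUnitary
  have hUU' : Uᴴ * U = 1 := Unitary.coe_star_mul_self hT.eigenvectorUnitary
  have hTU : T = U * diagonal (fun a => (t a : ℂ)) * Uᴴ := by
    have := hT.spectral_theorem
    rwa [Unitary.conjStarAlgAut_apply] at this
  let u : (m ⊕ κ) → ℓ → ℂ := fun a i => (Vᴴ * U) i a
  have hsum : ∀ g : (m ⊕ κ) → ℂ, ∑ a, g a • vecMulVec (u a) (star (u a)) =
      Vᴴ * (U * diagonal g * (Uᴴ * V)) := by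
    intro g
    have h1 : Vᴴ * (U * diagonal g * (Uᴴ * V)) = (Vᴴ * U) * diagonal g * (Vᴴ * U)ᴴ := by
      simp [conjTranspose_mul, Matrix.mul_assoc]
    rw [h1]
    ext i j
    rw [Matrix.mul_apply, Matrix.sum_apply]
    refine Finset.sum_congr rfl fun a _ => ?_
    rw [mul_diagonal, conjTranspose_apply]
    simp only [Matrix.smul_apply, vecMulVec_apply, u, Pi.star_apply, smul_eq_mul]
    ring
  refine ⟨⟨m ⊕ κ, t, fun a => vecMulVec (u a) (star (u a)),
    fun a => posSemidef_vecMulVec_self_star _⟩, ?_, fun z hz => ?_⟩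
  · change ∑ a, (1 : ℂ) • vecMulVec (u a) (star (u a)) = _
    rw [hsum fun _ => 1, ← realizationVec_gram hH hJ, diagonal_one, Matrix.mul_one,
      ← Matrix.mul_assoc U, hUU, Matrix.one_mul]
  · have htz : ∀ a, (t a : ℂ) - z ≠ 0 := fun k h => hz (by
      have := congrArg Complex.im h
      simpa using this)
    change _ * (J + ∑ a, ((t a : ℂ) - z)⁻¹ • vecMulVec (u a) (star (u a))) = 1
    rw [hsum]
    refine realization_mul_eq_one hH hJ he heJ hHJ hz ?_
    rw [← hTdef, ← hVdef]
    have h1 : T * (U * diagonal (fun a => ((t a : ℂ) - z)⁻¹) * (Uᴴ * V)) =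
        U * (diagonal (fun a => (t a : ℂ)) * diagonal (fun a => ((t a : ℂ) - z)⁻¹)) *
          (Uᴴ * V) := by
      rw [hTU]
      simp only [Matrix.mul_assoc]
      rw [← Matrix.mul_assoc Uᴴ U, hUU', Matrix.one_mul]
    have h2 : z • (U * diagonal (fun a => ((t a : ℂ) - z)⁻¹) * (Uᴴ * V)) =
        U * diagonal (fun a => z * ((t a : ℂ) - z)⁻¹) * (Uᴴ * V) := by
      have : diagonal (fun a => z * ((t a : ℂ) - z)⁻¹) =
          z • diagonal (fun a => ((t a : ℂ) - z)⁻¹) := by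
        ext i j; simp [diagonal_apply]
      rw [this]; simp
    have h3 : diagonal (fun a => (t a : ℂ) * ((t a : ℂ) - z)⁻¹) -
        diagonal (fun a => z * ((t a : ℂ) - z)⁻¹) = 1 := by
      rw [Matrix.diagonal_sub, ← diagonal_one]
      congr 1
      funext a
      rw [← sub_mul, mul_inv_cancel₀ (htz a)]
    rw [h1, h2, diagonal_mul_diagonal, ← Matrix.sub_mul, ← Matrix.mul_sub, h3, Matrix.mul_one,
      ← Matrix.mul_assoc, hUU, Matrix.one_mul]

/-- Positivity of `S` lets each `S (μ.wt j)` be factored as `Cᴴ C`. Stacking the factors, with the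
position of the atom repeated along its block, brings `S` of the transform into the form `Cᴴ (D -
z)⁻¹ C`. -/
theorem AtomicMeasure.exists_step {m : Type} [Fintype m] [DecidableEq m] {e : Matrix m ℓ ℂ}
    {H J : Matrix ℓ ℓ ℂ} (hH : H.IsHermitian) (hJ : J.IsHermitian) (he : e * eᴴ = 1)
    (heJ : e * J = 0) (hHJ : (1 - eᴴ * e) * (H * J) = 1 - eᴴ * e)
    (S : Matrix ℓ ℓ ℂ →ₗ[ℂ] Matrix ℓ ℓ ℂ) (hS : ∀ W, W.PosSemidef → (S W).PosSemidef)
    (μ : AtomicMeasure ℓ) :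
    ∃ ν : AtomicMeasure ℓ,
      ν.integral 1 = (1 - J * H) * (eᴴ * e) * (1 - H * J) + J * S (μ.integral 1) * J ∧
      ∀ z : ℂ, z.im ≠ 0 →
        (H - z • (eᴴ * e) - S (μ.integral fun x => ((x : ℂ) - z)⁻¹)) *
          (J + ν.integral fun x => ((x : ℂ) - z)⁻¹) = 1 := by
  classical
  choose C hC using fun j => (hS _ (μ.psd j)).exists_conjTranspose_mul_self
  let C' : Matrix (μ.idx × ℓ) ℓ ℂ := Matrix.of fun k b => C k.1 k.2 b
  have key : ∀ g : μ.idx → ℂ, C'ᴴ * (diagonal (fun k => g k.1) : Matrix (μ.idx × ℓ) (μ.idx × ℓ) ℂ) * C' = S (∑ j, g j • μ.wt j) := by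
    intro g
    simp only [map_sum, map_smul, hC]
    ext a b
    rw [Matrix.mul_apply, Fintype.sum_prod_type, Matrix.sum_apply]
    refine Finset.sum_congr rfl fun j _ => ?_
    rw [Matrix.smul_apply, Matrix.mul_apply, Finset.smul_sum]
    refine Finset.sum_congr rfl fun c _ => ?_
    rw [mul_diagonal]
    simp only [conjTranspose_apply, smul_eq_mul, C', Matrix.of_apply]
    ring
  obtain ⟨ν, h1, h2⟩ := exists_atomic_resolvent C' (fun k => μ.pos k.1) hH hJ he heJ hHJ
  refine ⟨ν, ?_, fun z hz => ?_⟩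
  · have := key fun _ => 1
    rw [diagonal_one, Matrix.mul_one] at this
    rw [h1, this]
    rfl
  · have := key fun j => ((μ.pos j : ℂ) - z)⁻¹
    rw [← h2 z hz, this]
    rfl

end Atomic

/-! ### Estimates and contraction near infinity -/

section SmallSolutions

variable {𝓐 : Type*} [NormedRing 𝓐] [NormedAlgebra ℂ 𝓐]

/-- Elements whose rows and columns along `p` are small. -/
def IsSmall (p : 𝓐) (ε K : ℝ) (G : 𝓐) : Prop :=
  ‖p * G‖ ≤ ε ∧ ‖G * p‖ ≤ ε ∧ ‖G‖ ≤ K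

/-- The algebraic data behind the Dyson equation `(H - S G - z p) G = 1`: on the complement of the
idempotent `p` the operator `S` only sees the corner `p W p`, and `H` has the inverse `J` there. -/
structure DysonData (p H J : 𝓐) (S : 𝓐 →ₗ[ℂ] 𝓐) : Prop where
  idem : p * p = p
  norm_p : ‖p‖ ≤ 1
  norm_q : ‖1 - p‖ ≤ 1
  p_mul_J : p * J = 0
  J_mul_p : J * p = 0
  J_mul_H : J * H * (1 - p) = 1 - p
  H_mul_J : (1 - p) * (H * J) = 1 - p
  left_corner : ∀ W, (1 - p) * S W = (1 - p) * S (p * W * p)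
  right_corner : ∀ W, S W * (1 - p) = S (p * W * p) * (1 - p)

namespace DysonData

variable {p H J : 𝓐} {S : 𝓐 →ₗ[ℂ] 𝓐}

theorem J_mul_S (D : DysonData p H J S) (W : 𝓐) : J * S W = J * S (p * W * p) := by
  have h : J = J * (1 - p) := by rw [mul_sub, mul_one, D.J_mul_p, sub_zero]
  calc J * S W = J * ((1 - p) * S W) := by rw [← mul_assoc, ← h]
    _ = J * S (p * W * p) := by rw [D.left_corner, ← mul_assoc, ← h]

theorem S_mul_J (D : DysonData p H J S) (W : 𝓐) : S W * J = S (p * W * p) * J := by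
  have h : J = (1 - p) * J := by rw [sub_mul, one_mul, D.p_mul_J, sub_zero]
  calc S W * J = S W * (1 - p) * J := by rw [mul_assoc, ← h]
    _ = S (p * W * p) * J := by rw [D.right_corner, mul_assoc, ← h]

/-- Multiplying by `J` kills `z p`, inverts `H` on the complement and reduces `S W` to the corner of
`W`. -/
theorem lower_rows (D : DysonData p H J S) {W G : 𝓐} {z : ℂ} (h : (H - S W - z • p) * G = 1) :
    (1 - p) * G = J - J * H * (p * G) + J * S (p * W * p) * G := by
  have h1 : J * ((H - S W - z • p) * G) = J := by rw [h, mul_one]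
  have h2 : J * ((H - S W - z • p) * G) = J * H * (p * G) + J * H * (1 - p) * G
      - J * S W * G - z • ((J * p) * G) := by
    simp only [sub_mul, mul_sub, smul_mul_assoc, mul_smul_comm, mul_one, mul_assoc]
    abel
  rw [h2, D.J_mul_p, D.J_mul_H, D.J_mul_S, zero_mul, smul_zero, sub_zero] at h1
  rw [sub_eq_iff_eq_add, ← eq_sub_iff_add_eq'] at h1
  rw [h1]
  abel

theorem right_cols (D : DysonData p H J S) {W G : 𝓐} {z : ℂ} (h : G * (H - S W - z • p) = 1) :
    G * (1 - p) = J - (G * p) * (H * J) + G * (S (p * W * p) * J) := by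
  have h1 : G * (H - S W - z • p) * J = J := by rw [h, one_mul]
  have h2 : G * (H - S W - z • p) * J = (G * p) * (H * J) + G * ((1 - p) * (H * J))
      - G * (S W * J) - z • (G * (p * J)) := by
    simp only [sub_mul, mul_sub, smul_mul_assoc, mul_smul_comm, one_mul, mul_assoc]
    abel
  rw [h2, D.p_mul_J, D.H_mul_J, D.S_mul_J, mul_zero, smul_zero, sub_zero] at h1
  rw [sub_eq_iff_eq_add, ← eq_sub_iff_add_eq'] at h1
  rw [h1]
  abel

/-- Multiplying by `p` isolates `z p G`, so the row decays like `1 / ‖z‖` as long as `G` is bounded.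
-/
theorem norm_smul_row (D : DysonData p H J S) {W G : 𝓐} {z : ℂ} {c K : ℝ}
    (hc : ∀ W, ‖S W‖ ≤ c * ‖W‖) (hc0 : 0 ≤ c) (hW : ‖W‖ ≤ K)
    (h : (H - S W - z • p) * G = 1) : ‖z‖ * ‖p * G‖ ≤ 1 + (‖H‖ + c * K) * ‖G‖ := by
  have h1 : z • (p * G) = p * ((H - S W) * G) - p := by
    have : p * ((H - S W - z • p) * G) = p := by rw [h, mul_one]
    nth_rw 3 [← this]
    simp only [sub_mul, mul_sub, smul_mul_assoc, mul_smul_comm]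
    rw [← mul_assoc p p G, D.idem]
    abel
  rw [← norm_smul, h1]
  have h2 : ‖(H - S W) * G‖ ≤ (‖H‖ + c * K) * ‖G‖ := by
    refine (norm_mul_le _ _).trans ?_
    gcongr
    refine (norm_sub_le _ _).trans ?_
    gcongr
    exact (hc W).trans (by gcongr)
  calc ‖p * ((H - S W) * G) - p‖ ≤ ‖p‖ * ‖(H - S W) * G‖ + ‖p‖ :=
        (norm_sub_le _ _).trans (by gcongr; exact norm_mul_le _ _)
    _ ≤ 1 * ‖(H - S W) * G‖ + 1 := by gcongr <;> exact D.norm_p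
    _ ≤ _ := by linarith

theorem norm_smul_col (D : DysonData p H J S) {W G : 𝓐} {z : ℂ} {c K : ℝ}
    (hc : ∀ W, ‖S W‖ ≤ c * ‖W‖) (hc0 : 0 ≤ c) (hW : ‖W‖ ≤ K)
    (h : G * (H - S W - z • p) = 1) : ‖z‖ * ‖G * p‖ ≤ 1 + (‖H‖ + c * K) * ‖G‖ := by
  have h1 : z • (G * p) = (G * (H - S W)) * p - p := by
    have : (G * (H - S W - z • p)) * p = p := by rw [h, one_mul]
    nth_rw 3 [← this]
    simp only [sub_mul, mul_sub, smul_mul_assoc, mul_smul_comm]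
    rw [mul_assoc G p p, D.idem]
    abel
  rw [← norm_smul, h1]
  have h2 : ‖G * (H - S W)‖ ≤ (‖H‖ + c * K) * ‖G‖ := by
    refine (norm_mul_le _ _).trans ?_
    rw [mul_comm]
    gcongr
    refine (norm_sub_le _ _).trans ?_
    gcongr
    exact (hc W).trans (by gcongr)
  calc ‖(G * (H - S W)) * p - p‖ ≤ ‖G * (H - S W)‖ * ‖p‖ + ‖p‖ :=
        (norm_sub_le _ _).trans (by gcongr; exact norm_mul_le _ _)
    _ ≤ ‖G * (H - S W)‖ * 1 + 1 := by gcongr <;> exact D.norm_p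
    _ ≤ _ := by linarith

omit [NormedAlgebra ℂ 𝓐] in
theorem norm_le_rows (G : 𝓐) : ‖G‖ ≤ ‖p * G‖ + ‖(1 - p) * G‖ := by
  have : G = p * G + (1 - p) * G := by rw [sub_mul, one_mul]; abel
  calc ‖G‖ = ‖p * G + (1 - p) * G‖ := by rw [← this]
    _ ≤ _ := norm_add_le _ _

omit [NormedAlgebra ℂ 𝓐] in
theorem norm_le_cols (G : 𝓐) : ‖G‖ ≤ ‖G * p‖ + ‖G * (1 - p)‖ := by
  have : G = G * p + G * (1 - p) := by rw [mul_sub, mul_one]; abel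
  calc ‖G‖ = ‖G * p + G * (1 - p)‖ := by rw [← this]
    _ ≤ _ := norm_add_le _ _

/-- The small corner of `W` makes the last term of `lower_rows` at most `‖G‖ / 4`; absorbing it
gives the factor `4 / 3`. -/
theorem norm_lower_rows (D : DysonData p H J S) {W G : 𝓐} {z : ℂ} {c a : ℝ}
    (hc : ∀ W, ‖S W‖ ≤ c * ‖W‖) (hc0 : 0 ≤ c) (ha : ‖p * W * p‖ ≤ a) (hsmall : ‖J‖ * (c * a) ≤ 1 / 4)
    (h : (H - S W - z • p) * G = 1) :
    ‖G‖ ≤ 4 / 3 * ‖J‖ + 4 / 3 * (‖J‖ * ‖H‖ + 1) * ‖p * G‖ := by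
  have h1 : ‖(1 - p) * G‖ ≤ ‖J‖ + ‖J‖ * ‖H‖ * ‖p * G‖ + ‖J‖ * (c * a) * ‖G‖ := by
    rw [D.lower_rows h]
    refine (norm_add_le _ _).trans (add_le_add ((norm_sub_le _ _).trans ?_) ?_)
    · gcongr
      exact (norm_mul_le _ _).trans (by gcongr; exact norm_mul_le _ _)
    · refine (norm_mul_le _ _).trans ?_
      gcongr
      refine (norm_mul_le _ _).trans ?_
      gcongr
      exact (hc _).trans (by gcongr)
  have h2 := norm_le_rows (p := p) G
  have h3 : ‖J‖ * (c * a) * ‖G‖ ≤ 1 / 4 * ‖G‖ := by gcongr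
  nlinarith [norm_nonneg (p * G)]

/-- Far from the real spectrum a step of the Dyson iteration preserves smallness. -/
theorem isSmall_step (D : DysonData p H J S) {c ε K R : ℝ}
    (hc : ∀ W, ‖S W‖ ≤ c * ‖W‖) (hc0 : 0 ≤ c) (hK : 2 * ‖J‖ + 1 ≤ K)
    (hsmall : ‖J‖ * (c * ε) ≤ 1 / 4) (hR : 0 < R)
    (hR1 : 4 / 3 * (‖J‖ * ‖H‖ + 1) * (1 + (‖H‖ + c * K)) ≤ R / 4)
    (hR2 : 1 + (‖H‖ + c * K) * K ≤ ε * R) {W G : 𝓐} {z : ℂ} (hW : ‖W‖ ≤ K)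
    (hpW : ‖p * W * p‖ ≤ ε) (hz : R ≤ ‖z‖)
    (h : (H - S W - z • p) * G = 1) (h' : G * (H - S W - z • p) = 1) : IsSmall p ε K G := by
  have hK0 : 0 ≤ K := (norm_nonneg W).trans hW
  have h1 := D.norm_lower_rows hc hc0 hpW hsmall h
  have h2 := D.norm_smul_row hc hc0 hW h
  have h3 := D.norm_smul_col hc hc0 hW h'
  have hg := norm_nonneg G
  have hh : 0 ≤ ‖H‖ + c * K := by positivity
  have hj := norm_nonneg J
  have hz' : R * ‖p * G‖ ≤ 1 + (‖H‖ + c * K) * ‖G‖ := le_trans (by gcongr) h2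
  have hz'' : R * ‖G * p‖ ≤ 1 + (‖H‖ + c * K) * ‖G‖ := le_trans (by gcongr) h3
  -- The row bound itself involves `‖G‖`; `hR1` makes its contribution at most `(1 + ‖G‖) / 4`,
  -- which is absorbed. The bound on `G` then feeds the row and column estimates.
  have hG : ‖G‖ ≤ K := by
    have h4 : 4 / 3 * (‖J‖ * ‖H‖ + 1) * ‖p * G‖ ≤ 1 / 4 * (1 + ‖G‖) := by
      have h5 : R * (4 / 3 * (‖J‖ * ‖H‖ + 1) * ‖p * G‖) ≤ R * (1 / 4 * (1 + ‖G‖)) := by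
        calc R * (4 / 3 * (‖J‖ * ‖H‖ + 1) * ‖p * G‖)
            = 4 / 3 * (‖J‖ * ‖H‖ + 1) * (R * ‖p * G‖) := by ring
          _ ≤ 4 / 3 * (‖J‖ * ‖H‖ + 1) * ((1 + (‖H‖ + c * K)) * (1 + ‖G‖)) := by
            exact mul_le_mul_of_nonneg_left (hz'.trans (by nlinarith)) (by positivity)
          _ = (4 / 3 * (‖J‖ * ‖H‖ + 1) * (1 + (‖H‖ + c * K))) * (1 + ‖G‖) := by ring
          _ ≤ (R / 4) * (1 + ‖G‖) := by gcongr
          _ = _ := by ring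
      exact le_of_mul_le_mul_left h5 hR
    linarith
  have hfin : 1 + (‖H‖ + c * K) * ‖G‖ ≤ ε * R := le_trans (by gcongr) hR2
  refine ⟨?_, ?_, hG⟩
  · exact le_of_mul_le_mul_left (a := R) (by linarith) hR
  · exact le_of_mul_le_mul_left (a := R) (by linarith) hR

/-- A solution of the Dyson equation with a small corner is small. -/
theorem isSmall_of_corner (D : DysonData p H J S) {c ε δ K : ℝ}
    (hc : ∀ W, ‖S W‖ ≤ c * ‖W‖) (hc0 : 0 ≤ c) (hK : 2 * ‖J‖ + 1 ≤ K)
    (hsmall : ‖J‖ * (c * δ) ≤ 1 / 4)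
    (hδ : 4 / 3 * (‖J‖ * ‖H‖ + 1) * δ ≤ ε) (hε : 4 / 3 * (‖J‖ * ‖H‖ + 1) * ε ≤ 1)
    {G : 𝓐} {z : ℂ} (hpG : ‖p * G * p‖ ≤ δ)
    (h : (H - S G - z • p) * G = 1) (h' : G * (H - S G - z • p) = 1) : IsSmall p ε K G := by
  have hδ0 : 0 ≤ δ := (norm_nonneg _).trans hpG
  have hSc : ‖S (p * G * p)‖ ≤ c * δ := (hc _).trans (by gcongr)
  have hrow : ‖p * G‖ ≤ ε := by
    -- Since `p J = 0`, the rest of the row is controlled by the corner alone, up to a term that is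
    -- absorbed.
    have h1 : p * G * (1 - p) = p * G * (S (p * G * p) * J) - (p * G * p) * (H * J) := by
      rw [mul_assoc, D.right_cols h', mul_add, mul_sub, D.p_mul_J]
      simp only [mul_assoc]
      abel
    have h2 : ‖p * G * (1 - p)‖ ≤ ‖p * G‖ * (c * δ * ‖J‖) + δ * (‖H‖ * ‖J‖) := by
      rw [h1]
      refine (norm_sub_le _ _).trans (add_le_add ?_ ?_)
      · refine (norm_mul_le _ _).trans ?_
        gcongr
        exact (norm_mul_le _ _).trans (by gcongr)
      · refine (norm_mul_le _ _).trans ?_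
        gcongr
        exact norm_mul_le _ _
    have h3 := norm_le_cols (p := p) (p * G)
    have h4 : ‖p * G‖ * (c * δ * ‖J‖) ≤ ‖p * G‖ * (1 / 4) := by gcongr; linarith
    nlinarith
  have hcol : ‖G * p‖ ≤ ε := by
    have h1 : (1 - p) * (G * p) = J * S (p * G * p) * (G * p) - J * H * (p * G * p) := by
      rw [← mul_assoc, D.lower_rows h, add_mul, sub_mul, D.J_mul_p]
      simp only [mul_assoc]
      abel
    have h2 : ‖(1 - p) * (G * p)‖ ≤ ‖J‖ * (c * δ) * ‖G * p‖ + ‖J‖ * ‖H‖ * δ := by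
      rw [h1]
      refine (norm_sub_le _ _).trans (add_le_add ?_ ?_)
      · refine (norm_mul_le _ _).trans ?_
        gcongr
        exact (norm_mul_le _ _).trans (by gcongr)
      · refine (norm_mul_le _ _).trans ?_
        gcongr
        exact norm_mul_le _ _
    have h3 := norm_le_rows (p := p) (G * p)
    have h4 : ‖J‖ * (c * δ) * ‖G * p‖ ≤ 1 / 4 * ‖G * p‖ := by gcongr
    have h5 : ‖p * (G * p)‖ ≤ δ := by rwa [← mul_assoc]
    nlinarith
  refine ⟨hrow, hcol, ?_⟩
  have h1 := D.norm_lower_rows hc hc0 hpG hsmall h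
  have h2 : 4 / 3 * (‖J‖ * ‖H‖ + 1) * ‖p * G‖ ≤ 1 := le_trans (by gcongr) hε
  have := norm_nonneg J
  linarith

/-- The difference of two steps of the Dyson iteration is contracted in a weighted norm. -/
theorem contraction (D : DysonData p H J S) {c ε K τ : ℝ}
    (hc : ∀ W, ‖S W‖ ≤ c * ‖W‖) (hc0 : 0 ≤ c) (hε0 : 0 ≤ ε) (hε1 : ε ≤ 1)
    (hτ : 2 * (K * K * c) ≤ τ) (hτε : ε * (c * (τ + K)) ≤ 1 / 2) (hτ0 : 0 ≤ τ)
    {G G' Δ : 𝓐} (hG : IsSmall p ε K G) (hG' : IsSmall p ε K G') :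
    τ * ‖p * (G * S Δ * G') * p‖ + ‖G * S Δ * G'‖ ≤ 1 / 2 * (τ * ‖p * Δ * p‖ + ‖Δ‖) := by
  have hK0 : 0 ≤ K := (norm_nonneg G).trans hG.2.2
  have h1 : ‖p * (G * S Δ * G') * p‖ ≤ ε * (c * ‖Δ‖) * 1 := by
    have : p * (G * S Δ * G') * p = p * G * S Δ * (G' * p) := by simp only [mul_assoc]
    rw [this]
    refine (norm_mul_le _ _).trans ?_
    gcongr
    · refine (norm_mul_le _ _).trans ?_
      gcongr
      · exact hG.1
      · exact hc _
    · exact hG'.2.1.trans hε1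
  have h2 : ‖G * S Δ * G'‖ ≤ ε * (c * ‖Δ‖) * K + K * (c * ‖p * Δ * p‖) * K := by
    -- The first term is small because `G p` is. The second is not small but sees only the corner of
    -- `Δ`, and the weight `τ` pays for it.
    have : G * S Δ * G' = G * p * S Δ * G' + G * ((1 - p) * S (p * Δ * p)) * G' := by
      rw [← D.left_corner]
      noncomm_ring
    rw [this]
    refine (norm_add_le _ _).trans (add_le_add ?_ ?_)
    · refine (norm_mul_le _ _).trans ?_
      gcongr
      · refine (norm_mul_le _ _).trans ?_
        gcongr
        · exact hG.2.1
        · exact hc _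
      · exact hG'.2.2
    · refine (norm_mul_le _ _).trans ?_
      gcongr
      · refine (norm_mul_le _ _).trans ?_
        gcongr
        · exact hG.2.2
        · refine (norm_mul_le _ _).trans ?_
          calc _ ≤ 1 * (c * ‖p * Δ * p‖) := by gcongr; exacts [D.norm_q, hc _]
            _ = _ := one_mul _
      · exact hG'.2.2
  calc τ * ‖p * (G * S Δ * G') * p‖ + ‖G * S Δ * G'‖
      ≤ τ * (ε * (c * ‖Δ‖) * 1) + (ε * (c * ‖Δ‖) * K + K * (c * ‖p * Δ * p‖) * K) := by gcongr
    _ = ε * (c * (τ + K)) * ‖Δ‖ + K * K * c * ‖p * Δ * p‖ := by ring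
    _ ≤ 1 / 2 * ‖Δ‖ + τ / 2 * ‖p * Δ * p‖ := by gcongr; linarith
    _ = _ := by ring

/-- Constants for which the Dyson iteration is well behaved near infinity. -/
theorem exists_constants (D : DysonData p H J S) {c : ℝ} (hc : ∀ W, ‖S W‖ ≤ c * ‖W‖)
    (hc0 : 0 ≤ c) : ∃ ε K R δ τ : ℝ, 0 < ε ∧ ‖J‖ + 1 ≤ K ∧ 0 < R ∧ 0 < δ ∧ 0 ≤ τ ∧
      (∀ (W G : 𝓐) (z : ℂ), ‖W‖ ≤ K → ‖p * W * p‖ ≤ ε → R ≤ ‖z‖ → (H - S W - z • p) * G = 1 →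
        G * (H - S W - z • p) = 1 → IsSmall p ε K G) ∧
      (∀ (G : 𝓐) (z : ℂ), ‖p * G * p‖ ≤ δ → (H - S G - z • p) * G = 1 →
        G * (H - S G - z • p) = 1 → IsSmall p ε K G) ∧
      (∀ G G' Δ : 𝓐, IsSmall p ε K G → IsSmall p ε K G' →
        τ * ‖p * (G * S Δ * G') * p‖ + ‖G * S Δ * G'‖ ≤ 1 / 2 * (τ * ‖p * Δ * p‖ + ‖Δ‖)) := by
  have hj := norm_nonneg J
  have hh := norm_nonneg H
  obtain ⟨K, hK⟩ : ∃ K, K = 2 * ‖J‖ + 1 := ⟨_, rfl⟩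
  have hK0 : 0 < K := by rw [hK]; positivity
  obtain ⟨τ, hτ⟩ : ∃ τ, τ = 2 * (K * K * c) := ⟨_, rfl⟩
  have hτ0 : 0 ≤ τ := by rw [hτ]; positivity
  -- Each summand yields one of the smallness conditions `b1`, `b2`, `b3` for `ε = 1 / s`, and the
  -- middle one gives `s ≥ 1`.
  obtain ⟨s, hs⟩ : ∃ s, s = 4 * (‖J‖ * c) + 4 / 3 * (‖J‖ * ‖H‖ + 1) + 2 * (c * (τ + K)) := ⟨_, rfl⟩
  have e1 : 0 ≤ ‖J‖ * c := by positivity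
  have e2 : 0 ≤ ‖J‖ * ‖H‖ := by positivity
  have e3 : 0 ≤ c * (τ + K) := by positivity
  have hs1 : 1 ≤ s := by linarith
  obtain ⟨ε, hε⟩ : ∃ ε, ε = 1 / s := ⟨_, rfl⟩
  have hε0 : 0 < ε := by rw [hε]; positivity
  have hsε : s * ε = 1 := by rw [hε]; field_simp
  have hε1 : ε ≤ 1 := by nlinarith
  have b1 : ‖J‖ * (c * ε) ≤ 1 / 4 := by nlinarith
  have b2 : 4 / 3 * (‖J‖ * ‖H‖ + 1) * ε ≤ 1 := by nlinarith
  have b3 : ε * (c * (τ + K)) ≤ 1 / 2 := by nlinarith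
  obtain ⟨δ, hδ⟩ : ∃ δ, δ = ε / (4 / 3 * (‖J‖ * ‖H‖ + 1)) := ⟨_, rfl⟩
  have hδ0 : 0 < δ := by rw [hδ]; positivity
  have hδε : 4 / 3 * (‖J‖ * ‖H‖ + 1) * δ = ε := by rw [hδ]; field_simp
  have hδle : δ ≤ ε := by nlinarith
  -- The two summands serve `r1` and `r2` respectively.
  obtain ⟨R, hR⟩ : ∃ R, R = 4 * (4 / 3 * (‖J‖ * ‖H‖ + 1) * (1 + (‖H‖ + c * K))) +
    (1 + (‖H‖ + c * K) * K) / ε := ⟨_, rfl⟩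
  have hR0 : 0 < R := by rw [hR]; positivity
  have r1 : 4 / 3 * (‖J‖ * ‖H‖ + 1) * (1 + (‖H‖ + c * K)) ≤ R / 4 := by
    have : 0 ≤ (1 + (‖H‖ + c * K) * K) / ε := by positivity
    linarith
  have r2 : 1 + (‖H‖ + c * K) * K ≤ ε * R := by
    have h1 : 0 ≤ ε * (4 * (4 / 3 * (‖J‖ * ‖H‖ + 1) * (1 + (‖H‖ + c * K)))) := by positivity
    have h2 : ε * ((1 + (‖H‖ + c * K) * K) / ε) = 1 + (‖H‖ + c * K) * K := by field_simp
    rw [hR, mul_add, h2]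
    linarith
  refine ⟨ε, K, R, δ, τ, hε0, by linarith, hR0, hδ0, hτ0, ?_, ?_, ?_⟩
  · intro W G z h1 h2 h3 h4 h5
    exact D.isSmall_step hc hc0 hK.ge b1 hR0 r1 r2 h1 h2 h3 h4 h5
  · intro G z h1 h2 h3
    exact D.isSmall_of_corner hc hc0 hK.ge (le_trans (by gcongr) b1) hδε.le b2 h1 h2 h3
  · intro G G' Δ h1 h2
    exact D.contraction hc hc0 hε0.le hε1 hτ.ge b3 hτ0 h1 h2

end DysonData

end SmallSolutions

/-! ### Mass, support and imaginary part of atomic measures -/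

section AtomicBounds

open Matrix Set Filter Topology
open scoped Matrix.Norms.Operator

variable {ℓ : Type} [Fintype ℓ] [DecidableEq ℓ]

theorem Matrix.norm_entry_le (A : Matrix ℓ ℓ ℂ) (i j : ℓ) : ‖A i j‖ ≤ ‖A‖ := by
  rw [linfty_opNorm_def]
  have h1 : ‖A i j‖₊ ≤ ∑ j, ‖A i j‖₊ :=
    Finset.single_le_sum (f := fun j => ‖A i j‖₊) (fun _ _ => zero_le) (Finset.mem_univ j)
  have h2 : ∑ j, ‖A i j‖₊ ≤ Finset.univ.sup fun i => ∑ j, ‖A i j‖₊ :=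
    Finset.le_sup (f := fun i => ∑ j, ‖A i j‖₊) (Finset.mem_univ i)
  exact_mod_cast h1.trans h2

theorem Matrix.norm_le_sum_entries (A : Matrix ℓ ℓ ℂ) : ‖A‖ ≤ ∑ i, ∑ j, ‖A i j‖ := by
  rw [linfty_opNorm_def]
  have : (Finset.univ.sup fun i => ∑ j, ‖A i j‖₊) ≤ ∑ i, ∑ j, ‖A i j‖₊ :=
    Finset.sup_le fun i _ =>
      Finset.single_le_sum (f := fun i => ∑ j, ‖A i j‖₊) (fun _ _ => zero_le) (Finset.mem_univ i)
  exact (NNReal.coe_le_coe.2 this).trans_eq (by simp)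

theorem Matrix.posSemidef_of_tendsto {u : ℕ → Matrix ℓ ℓ ℂ} {A : Matrix ℓ ℓ ℂ}
    (hu : Tendsto u atTop (𝓝 A)) (h : ∀ k, (u k).PosSemidef) : A.PosSemidef := by
  refine posSemidef_of_forall_real A fun v => ?_
  have hc : Continuous fun X : Matrix ℓ ℓ ℂ => star v ⬝ᵥ X *ᵥ v := by fun_prop
  exact ge_of_tendsto' ((hc.tendsto A).comp hu) fun k => (h k).dotProduct_mulVec_nonneg v

/-- A bound for the mass of the entries of a positive matrix measure in terms of its total mass. -/
noncomputable def massBound (A : Matrix ℓ ℓ ℂ) : ℝ :=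
  ∑ a, ∑ b, ∑ k : Fin 4, (star (polVec a b k) ⬝ᵥ A *ᵥ polVec a b k).re

namespace AtomicMeasure

variable (μ : AtomicMeasure ℓ)

omit [Fintype ℓ] [DecidableEq ℓ] in
theorem integral_add (f g : ℝ → ℂ) : μ.integral (f + g) = μ.integral f + μ.integral g := by
  simp [integral, add_smul, Finset.sum_add_distrib]

omit [Fintype ℓ] [DecidableEq ℓ] in
theorem integral_smul (c : ℂ) (f : ℝ → ℂ) : μ.integral (c • f) = c • μ.integral f := by
  simp [integral, Finset.smul_sum, mul_smul]

omit [Fintype ℓ] [DecidableEq ℓ] in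
theorem integral_sub (f g : ℝ → ℂ) : μ.integral (f - g) = μ.integral f - μ.integral g := by
  simp [integral, sub_smul, Finset.sum_sub_distrib]

/-- The measure has no mass outside `[-R, R]`. -/
def SupportedIn (R : ℝ) : Prop := ∀ j, μ.pos j ∉ Icc (-R) R → μ.wt j = 0

variable {μ}

omit [Fintype ℓ] [DecidableEq ℓ] in
theorem SupportedIn.integral_congr {R : ℝ} (hμ : μ.SupportedIn R) {f g : ℝ → ℂ}
    (h : ∀ x ∈ Icc (-R) R, f x = g x) : μ.integral f = μ.integral g := by
  refine Finset.sum_congr rfl fun j _ => ?_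
  by_cases hj : μ.pos j ∈ Icc (-R) R
  · rw [h _ hj]
  · rw [hμ j hj, smul_zero, smul_zero]

/-- Polarization bounds each entry of a weight by nonnegative forms, which add up over the atoms to
forms of the total mass. The bound is thus uniform over measures with the same mass. -/
theorem SupportedIn.norm_integral_le {R : ℝ} (hμ : μ.SupportedIn R) {f : ℝ → ℂ} {C : ℝ}
    (hC : 0 ≤ C) (h : ∀ x ∈ Icc (-R) R, ‖f x‖ ≤ C) :
    ‖μ.integral f‖ ≤ C * massBound (μ.integral 1) := by
  refine (norm_le_sum_entries _).trans ?_
  rw [massBound, Finset.mul_sum]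
  refine Finset.sum_le_sum fun a _ => ?_
  rw [Finset.mul_sum]
  refine Finset.sum_le_sum fun b _ => ?_
  have hq : ∀ v : ℓ → ℂ, star v ⬝ᵥ μ.integral 1 *ᵥ v = ∑ j, star v ⬝ᵥ μ.wt j *ᵥ v := by
    intro v
    simp [integral, Matrix.sum_mulVec, dotProduct_sum]
  simp only [hq, Complex.re_sum]
  rw [Finset.sum_comm, Finset.mul_sum]
  have : μ.integral f a b = ∑ j, f (μ.pos j) * μ.wt j a b := by
    simp [integral, Matrix.sum_apply]
  rw [this]
  refine (norm_sum_le _ _).trans (Finset.sum_le_sum fun j _ => ?_)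
  rw [norm_mul]
  have hw : ‖μ.wt j a b‖ ≤ ∑ k : Fin 4, (star (polVec a b k) ⬝ᵥ μ.wt j *ᵥ polVec a b k).re := by
    rw [polarization_entry (μ.wt j) a b]
    refine (norm_sum_le _ _).trans (Finset.sum_le_sum fun k _ => ?_)
    have h0 := Complex.nonneg_iff.1 ((μ.psd j).dotProduct_mulVec_nonneg (polVec a b k))
    have h1 : ‖(star (polVec a b k) ⬝ᵥ μ.wt j *ᵥ polVec a b k)‖ =
        (star (polVec a b k) ⬝ᵥ μ.wt j *ᵥ polVec a b k).re :=
      (Complex.re_eq_norm.2 ((μ.psd j).dotProduct_mulVec_nonneg (polVec a b k))).symm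
    rw [norm_mul, h1]
    have h2 : ‖(-Complex.I) ^ (k : ℕ) / 4‖ ≤ 1 := by
      rw [norm_div, norm_pow, norm_neg, Complex.norm_I, one_pow]; norm_num
    calc _ ≤ 1 * _ := mul_le_mul_of_nonneg_right h2 h0.1
      _ = _ := one_mul _
  by_cases hj : μ.pos j ∈ Icc (-R) R
  · exact mul_le_mul (h _ hj) hw (norm_nonneg _) hC
  · rw [hμ j hj]; simp

/-- The kernel of the Stieltjes transform. -/
noncomputable def _root_.cauchyKernel (z : ℂ) (x : ℝ) : ℂ := ((x : ℂ) - z)⁻¹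

theorem _root_.ofReal_sub_ne_zero {z : ℂ} (hz : z.im ≠ 0) (x : ℝ) : (x : ℂ) - z ≠ 0 := fun h => hz (by
  have := congrArg Complex.im h
  simpa using this)

theorem _root_.cauchyKernel_im (z : ℂ) (x : ℝ) :
    (cauchyKernel z x).im = z.im / Complex.normSq ((x : ℂ) - z) := by
  rw [cauchyKernel, Complex.inv_im]; simp

/-- Directly above an atom at height `η` the transform has diagonal imaginary part at least the
diagonal of the weight over `η`. Boundedness as `η → 0` leaves a positive semidefinite weight of
trace zero. -/
theorem supportedIn_of_bounded {R K : ℝ}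
    (h : ∀ z : ℂ, z.im ≠ 0 → R ≤ ‖z‖ → ‖μ.integral (cauchyKernel z)‖ ≤ K) : μ.SupportedIn R := by
  intro j hj
  have hR : R ≤ |μ.pos j| := by
    by_contra hlt
    exact hj (abs_le.1 (not_le.1 hlt).le)
  have hdiag : ∀ i, μ.wt j i i = 0 := by
    intro i
    have hnn : ∀ j, 0 ≤ μ.wt j i i := fun j => (μ.psd j).diag_nonneg
    have hη : ∀ η : ℝ, 0 < η → (μ.wt j i i).re ≤ η * K := by
      intro η hη
      let z : ℂ := ⟨μ.pos j, η⟩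
      have hz : z.im ≠ 0 := hη.ne'
      have hzR : R ≤ ‖z‖ := hR.trans (Complex.abs_re_le_norm z)
      have h1 : (μ.integral (cauchyKernel z) i i).im ≤ K :=
        (Complex.abs_im_le_norm _).trans' (le_abs_self _) |>.trans
          ((norm_entry_le _ i i).trans (h z hz hzR))
      have h2 : (μ.integral (cauchyKernel z) i i).im =
          ∑ j, (cauchyKernel z (μ.pos j)).im * (μ.wt j i i).re := by
        rw [integral, Matrix.sum_apply, Complex.im_sum]
        refine Finset.sum_congr rfl fun j _ => ?_
        rw [Matrix.smul_apply, smul_eq_mul, Complex.mul_im, ← (Complex.nonneg_iff.1 (hnn j)).2]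
        ring
      have h3 : (cauchyKernel z (μ.pos j)).im * (μ.wt j i i).re ≤ K := by
        refine le_trans ?_ (h2 ▸ h1)
        refine Finset.single_le_sum (f := fun j => (cauchyKernel z (μ.pos j)).im * (μ.wt j i i).re)
          (fun j _ => mul_nonneg ?_ (Complex.nonneg_iff.1 (hnn j)).1) (Finset.mem_univ j)
        rw [cauchyKernel_im]
        exact div_nonneg hη.le (Complex.normSq_nonneg _)
      have h4 : (cauchyKernel z (μ.pos j)).im = 1 / η := by
        rw [cauchyKernel_im]
        have : (μ.pos j : ℂ) - z = ⟨0, -η⟩ := by apply Complex.ext <;> simp [z]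
        rw [this, Complex.normSq_mk]
        simp [z]
      rw [h4, one_div, inv_mul_le_iff₀ hη] at h3
      exact h3
    have h5 : (μ.wt j i i).re ≤ 0 := by
      have ht : Tendsto (fun η : ℝ => η * K) (𝓝[>] 0) (𝓝 0) := by
        have : Tendsto (fun η : ℝ => η * K) (𝓝 0) (𝓝 (0 * K)) := tendsto_id.mul_const K
        rw [zero_mul] at this
        exact this.mono_left nhdsWithin_le_nhds
      exact ge_of_tendsto ht (eventually_nhdsWithin_of_forall fun η hη' => hη η hη')
    have h6 := Complex.nonneg_iff.1 (hnn j)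
    exact Complex.ext (le_antisymm h5 h6.1) h6.2.symm
  have htr : (μ.wt j).trace = 0 := by simp [Matrix.trace, hdiag]
  exact (μ.psd j).trace_eq_zero_iff.1 htr

omit [Fintype ℓ] [DecidableEq ℓ] in
/-- A lower bound for the imaginary part of the Stieltjes transform. -/
theorem SupportedIn.imaginaryPart_lower_bound {R : ℝ} (hμ : μ.SupportedIn R) {z : ℂ}
    (hz : 0 < z.im) :
    ((ℑ (μ.integral (cauchyKernel z)) : Matrix ℓ ℓ ℂ) -
      (z.im / (|R| + ‖z‖) ^ 2 : ℝ) • μ.integral 1).PosSemidef := by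
  have h1 : (ℑ (μ.integral (cauchyKernel z)) : Matrix ℓ ℓ ℂ) =
      ∑ j, (cauchyKernel z (μ.pos j)).im • μ.wt j := by
    rw [integral, map_sum, AddSubgroup.val_finsetSum]
    refine Finset.sum_congr rfl fun j _ => ?_
    rw [imaginaryPart_smul, (show IsSelfAdjoint (μ.wt j) from (μ.psd j).isHermitian).imaginaryPart]
    simp [(show IsSelfAdjoint (μ.wt j) from (μ.psd j).isHermitian).coe_realPart]
  rw [h1, integral, Finset.smul_sum, ← Finset.sum_sub_distrib]
  refine posSemidef_sum _ fun j _ => ?_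
  by_cases hj : μ.pos j ∈ Icc (-R) R
  · simp only [Pi.one_apply, one_smul]
    rw [← sub_smul]
    refine (μ.psd j).smul (sub_nonneg.2 ?_)
    rw [cauchyKernel_im, Complex.normSq_eq_norm_sq]
    have hpos : 0 < ‖(μ.pos j : ℂ) - z‖ := norm_pos_iff.2 (ofReal_sub_ne_zero hz.ne' _)
    have hle : ‖(μ.pos j : ℂ) - z‖ ≤ |R| + ‖z‖ := by
      refine (norm_sub_le _ _).trans ?_
      gcongr
      rw [Complex.norm_real, Real.norm_eq_abs]
      exact (abs_le.2 hj).trans (le_abs_self R)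
    gcongr
  · rw [hμ j hj]
    simpa using PosSemidef.zero

end AtomicMeasure

end AtomicBounds

/-! ### From convergent transforms to convergent integrals -/

section WeakLimits

open Matrix Set Filter Topology
open scoped Matrix.Norms.Operator

variable {ℓ : Type} [Fintype ℓ] [DecidableEq ℓ]

/-- The integrals of `f` against a sequence of atomic measures converge. -/
def IntegralsConverge (μ : ℕ → AtomicMeasure ℓ) (f : ℝ → ℂ) : Prop :=
  ∃ L, Tendsto (fun k => (μ k).integral f) atTop (𝓝 L)

variable {μ : ℕ → AtomicMeasure ℓ} {R : ℝ} {T : Matrix ℓ ℓ ℂ}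

omit [Fintype ℓ] [DecidableEq ℓ] in
theorem IntegralsConverge.add {f g : ℝ → ℂ} (hf : IntegralsConverge μ f)
    (hg : IntegralsConverge μ g) : IntegralsConverge μ (f + g) := by
  obtain ⟨L, hL⟩ := hf
  obtain ⟨L', hL'⟩ := hg
  exact ⟨L + L', (hL.add hL').congr fun k => ((μ k).integral_add f g).symm⟩

omit [Fintype ℓ] [DecidableEq ℓ] in
theorem IntegralsConverge.smul {f : ℝ → ℂ} (c : ℂ) (hf : IntegralsConverge μ f) :
    IntegralsConverge μ (c • f) := by
  obtain ⟨L, hL⟩ := hf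
  exact ⟨c • L, (hL.const_smul c).congr fun k => ((μ k).integral_smul c f).symm⟩

omit [Fintype ℓ] [DecidableEq ℓ] in
theorem IntegralsConverge.congr (hsupp : ∀ k, (μ k).SupportedIn R) {f g : ℝ → ℂ}
    (hf : IntegralsConverge μ f) (h : ∀ x ∈ Icc (-R) R, f x = g x) : IntegralsConverge μ g := by
  obtain ⟨L, hL⟩ := hf
  exact ⟨L, hL.congr fun k => (hsupp k).integral_congr h⟩

theorem massBound_nonneg (hmass : ∀ k, (μ k).integral 1 = T) : 0 ≤ massBound T := by
  rw [← hmass 0]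
  refine Finset.sum_nonneg fun a _ => Finset.sum_nonneg fun b _ => Finset.sum_nonneg fun k _ => ?_
  have h : ((μ 0).integral 1).PosSemidef :=
    posSemidef_sum _ fun j _ => by simpa using (μ 0).psd j
  exact (Complex.nonneg_iff.1 (h.dotProduct_mulVec_nonneg _)).1

theorem integralsConverge_of_approx (hsupp : ∀ k, (μ k).SupportedIn R)
    (hmass : ∀ k, (μ k).integral 1 = T) {f : ℝ → ℂ}
    (h : ∀ ε > 0, ∃ g, IntegralsConverge μ g ∧ ∀ x ∈ Icc (-R) R, ‖f x - g x‖ ≤ ε) :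
    IntegralsConverge μ f := by
  refine cauchySeq_tendsto_of_complete (Metric.cauchySeq_iff.2 fun ε hε => ?_)
  have hB := massBound_nonneg hmass
  -- The `+ 1` keeps the quotient meaningful when the mass bound is zero.
  obtain ⟨g, ⟨L, hL⟩, hg⟩ := h (ε / (3 * (massBound T + 1))) (by positivity)
  have happrox : ∀ k, dist ((μ k).integral f) ((μ k).integral g) < ε / 3 := by
    intro k
    rw [dist_eq_norm, ← AtomicMeasure.integral_sub]
    refine ((hsupp k).norm_integral_le (C := ε / (3 * (massBound T + 1))) (by positivity)
      fun x hx => hg x hx).trans_lt ?_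
    rw [hmass k, div_mul_eq_mul_div, div_lt_div_iff₀ (by positivity) (by positivity)]
    nlinarith
  obtain ⟨N, hN⟩ := Metric.cauchySeq_iff.1 hL.cauchySeq (ε / 3) (by positivity)
  refine ⟨N, fun m hm n hn => ?_⟩
  have h1 := happrox m
  have h2 := happrox n
  have h3 := hN m hm n hn
  rw [dist_comm] at h2
  have h4 := dist_triangle4 ((μ m).integral f) ((μ m).integral g) ((μ n).integral g)
    ((μ n).integral f)
  linarith

/-- Convergence of the Stieltjes transforms far up the imaginary axis implies convergence of all
moments. -/
theorem integralsConverge_pow (hsupp : ∀ k, (μ k).SupportedIn R)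
    (hmass : ∀ k, (μ k).integral 1 = T) {y₀ : ℝ} (hy₀ : 0 < y₀)
    (hk : ∀ y : ℝ, y₀ ≤ y → IntegralsConverge μ (cauchyKernel (y * Complex.I))) (n : ℕ) :
    (∀ y : ℝ, y₀ ≤ y →
      IntegralsConverge μ fun x => (x : ℂ) ^ n * cauchyKernel (y * Complex.I) x) ∧
      IntegralsConverge μ fun x => (x : ℂ) ^ n := by
  have hne : ∀ y : ℝ, y₀ ≤ y → ∀ x : ℝ, (x : ℂ) - y * Complex.I ≠ 0 := fun y hy x =>
    ofReal_sub_ne_zero (by simpa using (hy₀.trans_le hy).ne') x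
  have hlim : ∀ n : ℕ, (∀ y : ℝ, y₀ ≤ y →
      IntegralsConverge μ fun x => (x : ℂ) ^ n * cauchyKernel (y * Complex.I) x) →
      IntegralsConverge μ fun x => (x : ℂ) ^ n := by
    intro n hn
    refine integralsConverge_of_approx hsupp hmass fun ε hε => ?_
    -- `-iy xⁿ / (x - iy)` differs from `xⁿ` by `xⁿ⁺¹ / (x - iy)`, of norm at most `|R|ⁿ⁺¹ / y` on
    -- the segment.
    obtain ⟨y, hy⟩ : ∃ y, y = max y₀ (|R| ^ (n + 1) / ε) := ⟨_, rfl⟩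
    have hy1 : y₀ ≤ y := hy ▸ le_max_left _ _
    have hy2 : |R| ^ (n + 1) ≤ ε * y := by
      have : |R| ^ (n + 1) / ε ≤ y := hy ▸ le_max_right _ _
      rw [div_le_iff₀ hε] at this
      linarith
    have hy0 : 0 < y := hy₀.trans_le hy1
    refine ⟨_, (hn y hy1).smul (-(y * Complex.I)), fun x hx => ?_⟩
    have h1 : (x : ℂ) ^ n - ((-(y * Complex.I)) • fun x : ℝ => (x : ℂ) ^ n *
        cauchyKernel (y * Complex.I) x) x = (x : ℂ) ^ (n + 1) * ((x : ℂ) - y * Complex.I)⁻¹ := by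
      simp only [Pi.smul_apply, smul_eq_mul, cauchyKernel]
      field_simp [hne y hy1 x]
      ring
    rw [h1, norm_mul, norm_inv, norm_pow, Complex.norm_real, Real.norm_eq_abs,
      ← div_eq_mul_inv]
    have hden : y ≤ ‖(x : ℂ) - y * Complex.I‖ := by
      have := Complex.abs_im_le_norm ((x : ℂ) - y * Complex.I)
      simpa [abs_of_pos hy0] using this
    have hnum : |x| ^ (n + 1) ≤ |R| ^ (n + 1) := by
      exact pow_le_pow_left₀ (abs_nonneg x) ((abs_le.2 hx).trans (le_abs_self R)) _
    rw [div_le_iff₀ (hy0.trans_le hden)]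
    calc |x| ^ (n + 1) ≤ ε * y := hnum.trans hy2
      _ ≤ _ := by gcongr
  induction n with
  | zero =>
    have h0 : ∀ y : ℝ, y₀ ≤ y →
        IntegralsConverge μ fun x => (x : ℂ) ^ 0 * cauchyKernel (y * Complex.I) x := by
      intro y hy
      simpa using hk y hy
    exact ⟨h0, hlim 0 h0⟩
  | succ n ih =>
    have h1 : ∀ y : ℝ, y₀ ≤ y →
        IntegralsConverge μ fun x => (x : ℂ) ^ (n + 1) * cauchyKernel (y * Complex.I) x := by
      intro y hy
      -- `xⁿ⁺¹ / (x - iy) = xⁿ + iy xⁿ / (x - iy)`.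
      refine (ih.2.add ((ih.1 y hy).smul (y * Complex.I))).congr hsupp fun x _ => ?_
      simp only [Pi.add_apply, Pi.smul_apply, smul_eq_mul, cauchyKernel]
      field_simp [hne y hy x]
      ring
    exact ⟨h1, hlim _ h1⟩

theorem integralsConverge_of_continuous (hsupp : ∀ k, (μ k).SupportedIn R)
    (hmass : ∀ k, (μ k).integral 1 = T) {y₀ : ℝ} (hy₀ : 0 < y₀)
    (hk : ∀ y : ℝ, y₀ ≤ y → IntegralsConverge μ (cauchyKernel (y * Complex.I)))
    (f : ℝ → ℂ) (hf : Continuous f) : IntegralsConverge μ f := by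
  have hpoly : ∀ p : Polynomial ℝ, IntegralsConverge μ fun x => ((p.eval x : ℝ) : ℂ) := by
    intro p
    induction p using Polynomial.induction_on' with
    | add p q hp hq =>
      refine (hp.add hq).congr hsupp fun x _ => ?_
      simp
    | monomial n a =>
      refine ((integralsConverge_pow hsupp hmass hy₀ hk n).2.smul (a : ℂ)).congr hsupp
        fun x _ => ?_
      simp
  have hreal : ∀ g : ℝ → ℝ, Continuous g → IntegralsConverge μ fun x => (g x : ℂ) := by
    intro g hg
    refine integralsConverge_of_approx hsupp hmass fun ε hε => ?_
    obtain ⟨p, hp⟩ := exists_polynomial_near_of_continuousOn (-R) R g hg.continuousOn ε hε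
    refine ⟨_, hpoly p, fun x hx => ?_⟩
    rw [← Complex.ofReal_sub, Complex.norm_real, Real.norm_eq_abs, abs_sub_comm]
    exact (hp x hx).le
  refine ((hreal _ (Complex.continuous_re.comp hf)).add
    ((hreal _ (Complex.continuous_im.comp hf)).smul Complex.I)).congr hsupp fun x _ => ?_
  simp [mul_comm Complex.I, Complex.re_add_im]

end WeakLimits

/-! ### The limit functional and holomorphy of its transform -/

section LimitFunctional

open Matrix Set Filter Topology
open scoped Matrix.Norms.Operator

variable {ℓ : Type} [Fintype ℓ] [DecidableEq ℓ]
variable {μ : ℕ → AtomicMeasure ℓ} {R : ℝ} {T : Matrix ℓ ℓ ℂ}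

theorem exists_limit_functional (hR : 0 ≤ R) (hsupp : ∀ k, (μ k).SupportedIn R)
    (hmass : ∀ k, (μ k).integral 1 = T)
    (hconv : ∀ f : ℝ → ℂ, Continuous f → IntegralsConverge μ f) :
    ∃ L : C(Icc (-R) R, ℝ) →ₗ[ℝ] Matrix ℓ ℓ ℂ, (∀ f, (∀ x, 0 ≤ f x) → (L f).PosSemidef) ∧
      L 1 = T ∧ ∀ f g : C(ℝ, ℝ),
        Tendsto (fun k => (μ k).integral fun x => (f x : ℂ) + g x * Complex.I) atTop
          (𝓝 (L (restrictIcc (-R) R f) + Complex.I • L (restrictIcc (-R) R g))) := by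
  have hRR : -R ≤ R := by linarith
  -- Any continuous extension would serve, as no mass lies outside the segment; this one also
  -- preserves nonnegativity.
  let E : C(Icc (-R) R, ℝ) → ℝ → ℂ := fun f x => ((IccExtend hRR f x : ℝ) : ℂ)
  have hE : ∀ f, Continuous (E f) := fun f =>
    Complex.continuous_ofReal.comp (f.continuous.Icc_extend' )
  choose L hL using fun f => hconv (E f) (hE f)
  let Λ : C(Icc (-R) R, ℝ) →ₗ[ℝ] Matrix ℓ ℓ ℂ :=
    { toFun := L
      map_add' := fun f g => by
        refine tendsto_nhds_unique (hL (f + g)) (((hL f).add (hL g)).congr fun k => ?_)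
        rw [← AtomicMeasure.integral_add]
        congr 1
        funext x
        simp [E, IccExtend]
      map_smul' := fun c f => by
        refine tendsto_nhds_unique (hL (c • f)) ?_
        have := ((hL f).const_smul (c : ℂ)).congr fun k =>
          ((μ k).integral_smul (c : ℂ) (E f)).symm
        have h2 : (RingHom.id ℝ) c • L f = (c : ℂ) • L f := by
          ext i j; simp
        rw [h2]
        refine this.congr fun k => ?_
        congr 1
        funext x
        simp [E, IccExtend] }
  have hrestrict : ∀ f : C(ℝ, ℝ),
      Tendsto (fun k => (μ k).integral fun x => (f x : ℂ)) atTop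
        (𝓝 (Λ (restrictIcc (-R) R f))) := by
    intro f
    refine (hL (restrictIcc (-R) R f)).congr fun k => (hsupp k).integral_congr fun x hx => ?_
    simp [E, IccExtend, projIcc_of_mem hRR hx, restrictIcc]
  refine ⟨Λ, fun f hf => ?_, ?_, fun f g => ?_⟩
  · refine posSemidef_of_tendsto (hL f) fun k => posSemidef_sum _ fun j _ =>
      ((μ k).psd j).smul ?_
    exact Complex.zero_le_real.2 (hf _)
  · refine tendsto_nhds_unique (hL 1) ?_
    have : ∀ k, (μ k).integral (E 1) = T := fun k => by
      rw [← hmass k]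
      congr 1
    simp [this]
  · refine ((hrestrict f).add ((hrestrict g).const_smul Complex.I)).congr fun k => ?_
    rw [← AtomicMeasure.integral_smul, ← AtomicMeasure.integral_add]
    congr 1
    funext x
    simp [mul_comm]

/-- The second order Taylor remainder of the kernel is `(z - w)² / ((x - w)² (x - z))`. Its
integrals are `O(‖z - w‖²)` uniformly in `k`, and this bound survives the limit. -/
theorem differentiableAt_of_tendsto_cauchyKernel (hsupp : ∀ k, (μ k).SupportedIn R)
    (hmass : ∀ k, (μ k).integral 1 = T)
    (hconv : ∀ f : ℝ → ℂ, Continuous f → IntegralsConverge μ f) {N : ℂ → Matrix ℓ ℓ ℂ}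
    (hN : ∀ z : ℂ, z.im ≠ 0 →
      Tendsto (fun k => (μ k).integral (cauchyKernel z)) atTop (𝓝 (N z)))
    {w : ℂ} (hw : w.im ≠ 0) (i j : ℓ) : DifferentiableAt ℂ (fun z => N z i j) w := by
  have hcont : ∀ z : ℂ, z.im ≠ 0 → Continuous (cauchyKernel z) := fun z hz =>
    (Complex.continuous_ofReal.sub continuous_const).inv₀ fun x => ofReal_sub_ne_zero hz x
  obtain ⟨D, hD⟩ := hconv (cauchyKernel w * cauchyKernel w) ((hcont w hw).mul (hcont w hw))
  have hker : ∀ z : ℂ, z.im ≠ 0 → ∀ x, ‖cauchyKernel z x‖ ≤ |z.im|⁻¹ := by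
    intro z hz x
    rw [cauchyKernel, norm_inv]
    have := Complex.abs_im_le_norm ((x : ℂ) - z)
    have h2 : 0 < |z.im| := abs_pos.2 hz
    simp only [Complex.sub_im, Complex.ofReal_im, zero_sub, abs_neg] at this
    gcongr
  have hB := massBound_nonneg hmass
  have hid : ∀ z : ℂ, z.im ≠ 0 → ∀ x, (cauchyKernel z - cauchyKernel w -
      (z - w) • (cauchyKernel w * cauchyKernel w)) x =
      (z - w) ^ 2 * (cauchyKernel w x ^ 2 * cauchyKernel z x) := by
    intro z hz x
    have h1 := ofReal_sub_ne_zero hz x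
    have h2 := ofReal_sub_ne_zero hw x
    simp only [Pi.sub_apply, Pi.smul_apply, Pi.mul_apply, smul_eq_mul, cauchyKernel]
    field_simp
    ring
  have hbound : ∀ z : ℂ, |w.im| / 2 ≤ |z.im| → ‖N z i j - N w i j - (z - w) • D i j‖ ≤
      (|w.im|⁻¹ ^ 2 * (|w.im| / 2)⁻¹ * massBound T) * ‖‖z - w‖ ^ 2‖ := by
    intro z hzw
    have hw2 : 0 < |w.im| / 2 := half_pos (abs_pos.2 hw)
    have hz : z.im ≠ 0 := abs_pos.1 (hw2.trans_le hzw)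
    have hlim : Tendsto (fun k => (μ k).integral (cauchyKernel z - cauchyKernel w -
        (z - w) • (cauchyKernel w * cauchyKernel w))) atTop (𝓝 (N z - N w - (z - w) • D)) := by
      refine (((hN z hz).sub (hN w hw)).sub (hD.const_smul (z - w))).congr fun k => ?_
      rw [AtomicMeasure.integral_sub, AtomicMeasure.integral_sub, AtomicMeasure.integral_smul]
    have hle : ‖N z - N w - (z - w) • D‖ ≤
        (‖z - w‖ ^ 2 * (|w.im|⁻¹ ^ 2 * (|w.im| / 2)⁻¹)) * massBound T := by
      refine le_of_tendsto hlim.norm (Eventually.of_forall fun k => ?_)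
      rw [← hmass k]
      refine (hsupp k).norm_integral_le (by positivity) fun x _ => ?_
      rw [hid z hz, norm_mul, norm_mul, norm_pow, norm_pow]
      gcongr
      · exact hker w hw x
      · exact (hker z hz x).trans (by gcongr)
    have h2 := (norm_entry_le (N z - N w - (z - w) • D) i j).trans hle
    simp only [Matrix.sub_apply, Matrix.smul_apply] at h2
    refine h2.trans_eq ?_
    rw [norm_pow, norm_norm]
    ring
  refine HasDerivAt.differentiableAt (f' := D i j) ?_
  rw [hasDerivAt_iff_isLittleO]
  refine (Asymptotics.IsBigO.of_bound
    (|w.im|⁻¹ ^ 2 * (|w.im| / 2)⁻¹ * massBound T) ?_).trans_isLittleO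
    (Asymptotics.isLittleO_pow_sub_sub w one_lt_two)
  have hc : ContinuousAt (fun z : ℂ => |z.im|) w := by fun_prop
  have : ∀ᶠ z in 𝓝 w, |w.im| / 2 < |z.im| :=
    hc.eventually (lt_mem_nhds (half_lt_self (abs_pos.2 hw)))
  filter_upwards [this] with z hz
  exact hbound z hz.le

end LimitFunctional

/-! ### The Dyson iteration -/

section DysonIteration

open Matrix Set Filter Topology
open scoped Matrix.Norms.Operator

variable {ℓ m : Type} [Fintype ℓ] [DecidableEq ℓ] [Fintype m] [DecidableEq m]

/-- A linear map that preserves positive semidefiniteness preserves Hermitian matrices. -/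
theorem map_isHermitian_of_posSemidef {S : Matrix ℓ ℓ ℂ →ₗ[ℂ] Matrix ℓ ℓ ℂ}
    (hS : ∀ W, W.PosSemidef → (S W).PosSemidef) {W : Matrix ℓ ℓ ℂ} (hW : W.IsHermitian) :
    (S W).IsHermitian := by
  have h1 : (S ((W + 1)ᴴ * (W + 1))).IsHermitian :=
    (hS _ (posSemidef_conjTranspose_mul_self _)).isHermitian
  have h2 : (S ((W - 1)ᴴ * (W - 1))).IsHermitian :=
    (hS _ (posSemidef_conjTranspose_mul_self _)).isHermitian
  -- A Hermitian matrix is a combination of two positive semidefinite ones.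
  have h3 : (4 : ℂ) • W = (W + 1)ᴴ * (W + 1) - (W - 1)ᴴ * (W - 1) := by
    simp only [conjTranspose_add, conjTranspose_sub, conjTranspose_one, hW.eq]
    rw [show (4 : ℂ) • W = (4 : ℕ) • W by norm_num [← Nat.cast_smul_eq_nsmul ℂ]]
    noncomm_ring
  have h4 : S W = (4 : ℂ)⁻¹ • (S ((W + 1)ᴴ * (W + 1)) - S ((W - 1)ᴴ * (W - 1))) := by
    rw [← map_sub, ← h3, map_smul, smul_smul]
    norm_num
  rw [h4, IsHermitian, conjTranspose_smul, conjTranspose_sub, h1.eq, h2.eq]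
  simp

/-- The total mass of the measure that represents the solution of the Dyson equation. -/
def dysonMass (p H J : Matrix ℓ ℓ ℂ) (S : Matrix ℓ ℓ ℂ →ₗ[ℂ] Matrix ℓ ℓ ℂ) : Matrix ℓ ℓ ℂ :=
  (1 - J * H) * p * (1 - H * J) + J * S p * J

variable {e : Matrix m ℓ ℂ} {H J : Matrix ℓ ℓ ℂ} {S : Matrix ℓ ℓ ℂ →ₗ[ℂ] Matrix ℓ ℓ ℂ}

omit [Fintype m] [DecidableEq m] in
-- Makes the hypothesis on the mass in `DysonData.exists_step` reproduce itself along the iteration.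
theorem DysonData.corner_dysonMass {p : Matrix ℓ ℓ ℂ} (D : DysonData p H J S) :
    p * dysonMass p H J S * p = p := by
  have h1 : p * dysonMass p H J S * p =
      (p - p * J * H) * p * (p - H * (J * p)) + p * J * S p * (J * p) := by
    rw [dysonMass]; noncomm_ring
  rw [h1, D.p_mul_J, D.J_mul_p]
  simp [D.idem]

/-- The term `S J` is absorbed into `H`. As the corner of `J` vanishes, `J * S J` and `S J * J` are
zero, so neither the inverse `J` nor the mass is affected. -/
theorem DysonData.exists_step (he : e * eᴴ = 1) (D : DysonData (eᴴ * e) H J S)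
    (hH : H.IsHermitian) (hJ : J.IsHermitian) (hS : ∀ W, W.PosSemidef → (S W).PosSemidef)
    (μ : AtomicMeasure ℓ) (hμ : (eᴴ * e) * μ.integral 1 * (eᴴ * e) = eᴴ * e) :
    ∃ ν : AtomicMeasure ℓ, ν.integral 1 = dysonMass (eᴴ * e) H J S ∧ ∀ z : ℂ, z.im ≠ 0 →
      (H - S (J + μ.integral (cauchyKernel z)) - z • (eᴴ * e)) *
        (J + ν.integral (cauchyKernel z)) = 1 := by
  have hcorner : (eᴴ * e) * J * (eᴴ * e) = 0 := by rw [D.p_mul_J, zero_mul]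
  have hJSJ : J * S J = 0 := by rw [D.J_mul_S, hcorner, map_zero, mul_zero]
  have hSJJ : S J * J = 0 := by rw [D.S_mul_J, hcorner, map_zero, zero_mul]
  have heJ : e * J = 0 := by
    calc e * J = e * eᴴ * e * J := by rw [he, Matrix.one_mul]
      _ = e * ((eᴴ * e) * J) := by simp only [Matrix.mul_assoc]
      _ = 0 := by rw [D.p_mul_J, Matrix.mul_zero]
  obtain ⟨ν, h1, h2⟩ := AtomicMeasure.exists_step (H := H - S J) (J := J) (e := e)
    (hH.sub (map_isHermitian_of_posSemidef hS hJ)) hJ he heJ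
    (by rw [sub_mul H, hSJJ, sub_zero, D.H_mul_J]) S hS μ
  refine ⟨ν, ?_, fun z hz => ?_⟩
  · rw [h1, dysonMass, mul_sub J H, hJSJ, sub_zero, sub_mul H, hSJJ, sub_zero, D.J_mul_S, hμ]
  · rw [← h2 z hz, map_add]
    congr 1
    change _ = H - S J - z • (eᴴ * e) - S (μ.integral (cauchyKernel z))
    abel

/-- The iterates of the Dyson equation as Stieltjes transforms of atomic measures with common
support and total mass, convergent near infinity. -/
theorem DysonData.exists_sequence (he : e * eᴴ = 1) (D : DysonData (eᴴ * e) H J S)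
    (hH : H.IsHermitian) (hJ : J.IsHermitian) (hS : ∀ W, W.PosSemidef → (S W).PosSemidef) :
    ∃ (R : ℝ) (μ : ℕ → AtomicMeasure ℓ), 0 < R ∧
      (∀ k, (μ k).integral 1 = dysonMass (eᴴ * e) H J S) ∧ (∀ k, (μ k).SupportedIn R) ∧
      (∀ k, ∀ z : ℂ, z.im ≠ 0 →
        (H - S (J + (μ k).integral (cauchyKernel z)) - z • (eᴴ * e)) *
          (J + (μ (k + 1)).integral (cauchyKernel z)) = 1) ∧
      ∀ y : ℝ, R ≤ y → IntegralsConverge μ (cauchyKernel (y * Complex.I)) := by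
  set p := eᴴ * e with hp
  obtain ⟨c, hc0, hc⟩ := (LinearMap.toContinuousLinearMap S).bound
  obtain ⟨ε, K, R', δ, τ, hε, hK, hR', hδ, hτ, hstep, -, hcontr⟩ :=
    D.exists_constants hc hc0.le
  -- Beyond `R'` a step preserves smallness; `1 + 1 / ε` makes the initial transform `-p / z` at
  -- most `1` and at most `ε` in norm.
  obtain ⟨R, hR⟩ : ∃ R, R = R' + 1 + 1 / ε := ⟨_, rfl⟩
  have hε' : 0 < 1 / ε := by positivity
  have hR0 : 0 < R := by linarith
  let Adm : AtomicMeasure ℓ → Prop := fun μ => p * μ.integral 1 * p = p ∧ ∀ z : ℂ, z.im ≠ 0 →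
    R ≤ ‖z‖ → ‖J + μ.integral (cauchyKernel z)‖ ≤ K ∧ ‖p * (J + μ.integral (cauchyKernel z)) * p‖ ≤ ε
  have hnext : ∀ μ : {μ // Adm μ}, ∃ ν : {ν // Adm ν},
      ν.1.integral 1 = dysonMass p H J S ∧ (∀ z : ℂ, z.im ≠ 0 →
        (H - S (J + μ.1.integral (cauchyKernel z)) - z • p) *
          (J + ν.1.integral (cauchyKernel z)) = 1) ∧ ∀ z : ℂ, z.im ≠ 0 → R ≤ ‖z‖ →
            IsSmall p ε K (J + ν.1.integral (cauchyKernel z)) := by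
    rintro ⟨μ, hμ1, hμ2⟩
    obtain ⟨ν, h1, h2⟩ := D.exists_step he hH hJ hS μ hμ1
    have h3 : ∀ z : ℂ, z.im ≠ 0 → R ≤ ‖z‖ →
        IsSmall p ε K (J + ν.integral (cauchyKernel z)) := by
      intro z hz hzR
      exact hstep _ _ z (hμ2 z hz hzR).1 (hμ2 z hz hzR).2 (by linarith) (h2 z hz)
        (mul_eq_one_comm.1 (h2 z hz))
    refine ⟨⟨ν, ?_, fun z hz hzR => ⟨(h3 z hz hzR).2.2, ?_⟩⟩, h1, h2, h3⟩
    · rw [h1, D.corner_dysonMass]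
    · calc _ ≤ ‖p * (J + ν.integral (cauchyKernel z))‖ * ‖p‖ := norm_mul_le _ _
        _ ≤ ε * 1 := by gcongr; exacts [(h3 z hz hzR).1, D.norm_p]
        _ = ε := mul_one _
  choose next hmass heq hsmall using hnext
  have hpsd : p.PosSemidef := posSemidef_conjTranspose_mul_self e
  let μ₀ : AtomicMeasure ℓ := ⟨Unit, fun _ => 0, fun _ => p, fun _ => hpsd⟩
  have hμ₀ : Adm μ₀ := by
    have hint : ∀ f, μ₀.integral f = f 0 • p := fun f => by
      simp [μ₀, AtomicMeasure.integral]
    refine ⟨by rw [hint]; simp [D.idem], fun z hz hzR => ?_⟩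
    have hz1 : ‖cauchyKernel z 0‖ = ‖z‖⁻¹ := by simp [cauchyKernel]
    have hb : ‖μ₀.integral (cauchyKernel z)‖ ≤ ‖z‖⁻¹ := by
      rw [hint, norm_smul, hz1]
      exact mul_le_of_le_one_right (by positivity) D.norm_p
    have hz2 : ‖z‖⁻¹ ≤ 1 := inv_le_one_of_one_le₀ (by linarith)
    have hz3 : ‖z‖⁻¹ ≤ ε := inv_le_of_inv_le₀ hε (by rw [← one_div]; linarith)
    constructor
    · exact (norm_add_le _ _).trans (by linarith)
    · rw [mul_add, D.p_mul_J, zero_add, hint]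
      rw [mul_smul_comm, smul_mul_assoc, D.idem, D.idem, norm_smul, hz1]
      exact (mul_le_of_le_one_right (by positivity) D.norm_p).trans hz3
  -- The shift discards `μ₀`, which need not have mass `dysonMass`; every remaining term is the
  -- output of a step.
  let ν : ℕ → {μ // Adm μ} := fun k => next^[k + 1] ⟨μ₀, hμ₀⟩
  have hν : ∀ k, ν (k + 1) = next (ν k) := fun k => Function.iterate_succ_apply' next (k + 1) _
  have hν' : ∀ k, ∃ ρ, ν k = next ρ := fun k =>
    ⟨next^[k] ⟨μ₀, hμ₀⟩, Function.iterate_succ_apply' next k _⟩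
  have hsm : ∀ k, ∀ z : ℂ, z.im ≠ 0 → R ≤ ‖z‖ →
      IsSmall p ε K (J + (ν k).1.integral (cauchyKernel z)) := by
    intro k
    obtain ⟨ρ, hρ⟩ := hν' k
    rw [hρ]
    exact hsmall ρ
  refine ⟨R, fun k => (ν k).1, hR0, fun k => ?_, fun k => ?_, fun k z hz => ?_, fun y hy => ?_⟩
  · obtain ⟨ρ, hρ⟩ := hν' k
    change (ν k).1.integral 1 = _
    rw [hρ]
    exact hmass ρ
  · refine AtomicMeasure.supportedIn_of_bounded (K := K + ‖J‖) fun z hz hzR => ?_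
    have h1 := (hsm k z hz hzR).2.2
    have h2 : (ν k).1.integral (cauchyKernel z) =
        (J + (ν k).1.integral (cauchyKernel z)) - J := by abel
    rw [h2]
    exact (norm_sub_le _ _).trans (by linarith)
  · simp only [hν]
    exact heq (ν k) z hz
  · set z : ℂ := y * Complex.I with hz
    have hy0 : 0 < y := hR0.trans_le hy
    have hzim : z.im ≠ 0 := by simp [hz, hy0.ne']
    have hzR : R ≤ ‖z‖ := by simpa [hz, abs_of_pos hy0] using hy
    set G : ℕ → Matrix ℓ ℓ ℂ := fun k => J + (ν k).1.integral (cauchyKernel z) with hG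
    have hGeq : ∀ k, (H - S (G k) - z • p) * G (k + 1) = 1 := fun k => by
      simp only [hG, hν]
      exact heq (ν k) z hzim
    -- The resolvent identity, in the shape to which the contraction applies.
    have hdiff : ∀ k, G (k + 2) - G (k + 1) = G (k + 2) * S (G (k + 1) - G k) * G (k + 1) := by
      intro k
      have h1 := hGeq k
      have h2 := mul_eq_one_comm.1 (hGeq (k + 1))
      have h3 : S (G (k + 1) - G k) =
          (H - S (G k) - z • p) - (H - S (G (k + 1)) - z • p) := by
        rw [map_sub]; abel
      rw [h3, mul_sub, sub_mul, h2, one_mul, mul_assoc, h1, mul_one]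
    let v : ℕ → ℝ := fun k => τ * ‖p * (G (k + 1) - G k) * p‖ + ‖G (k + 1) - G k‖
    have hv : ∀ k, v (k + 1) ≤ 1 / 2 * v k := by
      intro k
      simp only [v]
      rw [hdiff k]
      exact hcontr _ _ _ (hsm (k + 2) z hzim hzR) (hsm (k + 1) z hzim hzR)
    have hv' : ∀ k, v k ≤ v 0 * (1 / 2) ^ k := by
      intro k
      induction k with
      | zero => simp
      | succ k ih => rw [pow_succ]; linarith [hv k]
    have hcauchy : CauchySeq G := by
      refine cauchySeq_of_le_geometric (1 / 2) (v 0) (by norm_num) fun k => ?_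
      rw [dist_comm, dist_eq_norm]
      refine le_trans ?_ (hv' k)
      simp only [v]
      have : 0 ≤ τ * ‖p * (G (k + 1) - G k) * p‖ := by positivity
      linarith
    obtain ⟨L, hL⟩ := cauchySeq_tendsto_of_complete hcauchy
    refine ⟨L - J, (hL.sub_const J).congr fun k => ?_⟩
    simp [hG]

end DysonIteration

/-! ### Existence and uniqueness for the abstract Dyson equation -/

section AbstractDyson

open Matrix Set Filter Topology
open scoped Matrix.Norms.Operator

variable {ℓ m : Type} [Fintype ℓ] [DecidableEq ℓ] [Fintype m] [DecidableEq m]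
variable {H J : Matrix ℓ ℓ ℂ} {S : Matrix ℓ ℓ ℂ →ₗ[ℂ] Matrix ℓ ℓ ℂ}

omit [Fintype ℓ] [DecidableEq ℓ] in
theorem imaginaryPart_matrix (A : Matrix ℓ ℓ ℂ) :
    (ℑ A : Matrix ℓ ℓ ℂ) = (-Complex.I / 2) • (A - Aᴴ) := by
  rw [imaginaryPart_apply_coe, star_eq_conjTranspose]
  ext i j
  simp
  ring

/-- The solution of the Dyson equation as the Stieltjes transform of a positive functional. -/
theorem DysonData.exists_solution {e : Matrix m ℓ ℂ} (he : e * eᴴ = 1)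
    (D : DysonData (eᴴ * e) H J S) (hH : H.IsHermitian) (hJ : J.IsHermitian)
    (hS : ∀ W, W.PosSemidef → (S W).PosSemidef) :
    ∃ (M : ℂ → Matrix ℓ ℓ ℂ) (R : ℝ) (L : C(Icc (-R) R, ℝ) →ₗ[ℝ] Matrix ℓ ℓ ℂ),
      (∀ f, (∀ x, 0 ≤ f x) → (L f).PosSemidef) ∧ L 1 = dysonMass (eᴴ * e) H J S ∧
      (∀ z : ℂ, z.im ≠ 0 → (H - S (M z) - z • (eᴴ * e)) * M z = 1) ∧
      (∀ z : ℂ, z.im ≠ 0 → ∀ i j, DifferentiableAt ℂ (fun z => M z i j) z) ∧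
      (∀ z : ℂ, z.im ≠ 0 → ∀ f g : C(ℝ, ℝ),
        (∀ x, (f x : ℂ) + g x * Complex.I = cauchyKernel z x) →
        M z - J = L (restrictIcc (-R) R f) + Complex.I • L (restrictIcc (-R) R g)) ∧
      ∀ z : ℂ, 0 < z.im → ∃ c : ℝ, 0 < c ∧
        ((ℑ (M z) : Matrix ℓ ℓ ℂ) - c • dysonMass (eᴴ * e) H J S).PosSemidef := by
  obtain ⟨R, μ, hR, hmass, hsupp, heq, hconv⟩ := D.exists_sequence he hH hJ hS
  have hcont : ∀ f : ℝ → ℂ, Continuous f → IntegralsConverge μ f :=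
    integralsConverge_of_continuous hsupp hmass hR hconv
  have hker : ∀ z : ℂ, z.im ≠ 0 → Continuous (cauchyKernel z) := fun z hz =>
    (Complex.continuous_ofReal.sub continuous_const).inv₀ fun x => ofReal_sub_ne_zero hz x
  have hex : ∀ z : ℂ, ∃ N, z.im ≠ 0 →
      Tendsto (fun k => (μ k).integral (cauchyKernel z)) atTop (𝓝 N) := by
    intro z
    by_cases hz : z.im ≠ 0
    · obtain ⟨N, hN⟩ := hcont _ (hker z hz)
      exact ⟨N, fun _ => hN⟩
    -- On the real axis the value is arbitrary.
    · exact ⟨0, fun h => absurd h hz⟩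
  choose N hN using hex
  obtain ⟨L, hLpos, hLmass, hL⟩ := exists_limit_functional hR.le hsupp hmass hcont
  have hScont : Continuous S := LinearMap.continuous_of_finiteDimensional S
  refine ⟨fun z => J + N z, R, L, hLpos, hLmass, fun z hz => ?_, fun z hz i j => ?_,
    fun z hz f g hfg => ?_, fun z hz => ?_⟩
  · have h1 : Tendsto (fun k => (H - S (J + (μ k).integral (cauchyKernel z)) - z • (eᴴ * e)) *
        (J + (μ (k + 1)).integral (cauchyKernel z))) atTop
        (𝓝 ((H - S (J + N z) - z • (eᴴ * e)) * (J + N z))) := by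
      have h2 := (hN z hz).const_add J
      refine Tendsto.mul ?_ (h2.comp (tendsto_add_atTop_nat 1))
      exact (tendsto_const_nhds.sub ((hScont.tendsto _).comp h2)).sub tendsto_const_nhds
    refine tendsto_nhds_unique h1 ?_
    simp only [heq _ z hz]
    exact tendsto_const_nhds
  · have := differentiableAt_of_tendsto_cauchyKernel hsupp hmass hcont hN hz i j
    simpa [Matrix.add_apply] using this.const_add (J i j)
  · rw [add_sub_cancel_left]
    refine tendsto_nhds_unique (hN z hz) ?_
    have := hL f g
    simp only [hfg] at this
    exact this
  -- A lower bound for the imaginary part of the kernel on `[-R, R]`; being independent of `k`, it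
  -- keeps the positivity strict in the limit.
  · refine ⟨z.im / (|R| + ‖z‖) ^ 2, ?_, ?_⟩
    · have : 0 < |R| := abs_pos.2 hR.ne'
      positivity
    · have h1 : (ℑ (J + N z) : Matrix ℓ ℓ ℂ) = (ℑ (N z) : Matrix ℓ ℓ ℂ) := by
        rw [map_add, (show IsSelfAdjoint J from hJ).imaginaryPart, zero_add]
      rw [h1]
      have hc : Continuous fun A : Matrix ℓ ℓ ℂ => (ℑ A : Matrix ℓ ℓ ℂ) -
          (z.im / (|R| + ‖z‖) ^ 2 : ℝ) • dysonMass (eᴴ * e) H J S := by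
        simp only [imaginaryPart_matrix]
        fun_prop
      refine posSemidef_of_tendsto ((hc.tendsto _).comp (hN z hz.ne')) fun k => ?_
      have := (hsupp k).imaginaryPart_lower_bound hz
      rw [hmass k] at this
      exact this

/-- With `N` the inverse of `G`, `G - Gᴴ = Gᴴ (Nᴴ - N) G`, and `S` commutes with the adjoint because
it preserves Hermitian matrices. -/
theorem imaginaryPart_eq_of_dyson {p : Matrix ℓ ℓ ℂ} (hp : p.IsHermitian) (hH : H.IsHermitian)
    (hS : ∀ W, W.PosSemidef → (S W).PosSemidef) {G : Matrix ℓ ℓ ℂ} {z : ℂ}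
    (h : (H - S G - z • p) * G = 1) :
    (ℑ G : Matrix ℓ ℓ ℂ) = Gᴴ * (S (ℑ G : Matrix ℓ ℓ ℂ) + z.im • p) * G := by
  have hSstar : S Gᴴ = (S G)ᴴ := by
    have h1 : G = (ℜ G : Matrix ℓ ℓ ℂ) + Complex.I • (ℑ G : Matrix ℓ ℓ ℂ) :=
      (realPart_add_I_smul_imaginaryPart G).symm
    have hre : (ℜ G : Matrix ℓ ℓ ℂ).IsHermitian := (ℜ G).2
    have him : (ℑ G : Matrix ℓ ℓ ℂ).IsHermitian := (ℑ G).2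
    rw [h1]
    simp only [conjTranspose_add, conjTranspose_smul, map_add, map_smul, hre.eq, him.eq,
      (map_isHermitian_of_posSemidef hS hre).eq, (map_isHermitian_of_posSemidef hS him).eq]
  set N := H - S G - z • p with hN
  have hNstar : Nᴴ = H - S Gᴴ - star z • p := by
    rw [hN, conjTranspose_sub, conjTranspose_sub, conjTranspose_smul, hH.eq, hp.eq, hSstar]
  have hG : Gᴴ * Nᴴ = 1 := by rw [← conjTranspose_mul, h, conjTranspose_one]
  have hdiff : G - Gᴴ = Gᴴ * (Nᴴ - N) * G := by
    rw [mul_sub, sub_mul, hG, one_mul, mul_assoc, h, mul_one]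
  have hNN : Nᴴ - N = S (G - Gᴴ) + (z - star z) • p := by
    rw [hNstar, hN, map_sub, sub_smul]
    abel
  have hz : (-Complex.I / 2) * (z - star z) = (z.im : ℂ) := by
    refine Complex.ext ?_ (by simp)
    simp
    ring
  rw [imaginaryPart_matrix, map_smul]
  nth_rw 1 [hdiff]
  rw [hNN, ← Matrix.smul_mul, ← Matrix.mul_smul, smul_add, smul_smul, hz]
  rfl

/-- The corner of a solution of the Dyson equation decays like `1 / Im z`. -/
theorem norm_corner_le_of_dyson {p : Matrix ℓ ℓ ℂ} (hp : p.IsHermitian) (hpp : p * p = p)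
    (hH : H.IsHermitian) (hS : ∀ W, W.PosSemidef → (S W).PosSemidef) {G : Matrix ℓ ℓ ℂ} {z : ℂ}
    (hz : 0 < z.im) (h : (H - S G - z • p) * G = 1) (hG : (ℑ G : Matrix ℓ ℓ ℂ).PosSemidef) :
    ‖p * G * p‖ ≤ (Fintype.card ℓ : ℝ) ^ 2 / z.im := by
  set X := p * G * p with hX
  -- Compressing the identity for `ℑ G` to the corner, the difference is the conjugate of `S (ℑ G) ⪰
  -- 0` by `G p`.
  have hpsd : ((ℑ X : Matrix ℓ ℓ ℂ) - z.im • (Xᴴ * X)).PosSemidef := by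
    have h1 : (ℑ X : Matrix ℓ ℓ ℂ) = p * (ℑ G : Matrix ℓ ℓ ℂ) * p := by
      rw [imaginaryPart_matrix, imaginaryPart_matrix, hX]
      simp only [conjTranspose_mul, hp.eq, Matrix.mul_smul, Matrix.smul_mul, mul_sub, sub_mul,
        mul_assoc]
    have h2 : (ℑ X : Matrix ℓ ℓ ℂ) - z.im • (Xᴴ * X) =
        (G * p)ᴴ * S (ℑ G : Matrix ℓ ℓ ℂ) * (G * p) := by
      have hY := imaginaryPart_eq_of_dyson hp hH hS h
      have h3 : Xᴴ * X = p * (Gᴴ * p * G) * p := by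
        simp only [hX, conjTranspose_mul, hp.eq, mul_assoc]
        rw [← mul_assoc p p, hpp]
      rw [h1, h3, conjTranspose_mul, hp.eq]
      generalize (ℑ G : Matrix ℓ ℓ ℂ) = Y at hY
      have h4 : p * Y * p = p * (Gᴴ * (S Y + z.im • p) * G) * p := by rw [← hY]
      rw [h4, mul_add, add_mul, mul_add, add_mul]
      simp only [Matrix.mul_smul, Matrix.smul_mul, mul_assoc]
      abel
    rw [h2]
    exact (hS _ hG).conjTranspose_mul_mul_same _
  have hentry : ∀ i, z.im * ∑ k, ‖X k i‖ ^ 2 ≤ (X i i).im := by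
    intro i
    have h1 := (Complex.nonneg_iff.1 (hpsd.diag_nonneg (i := i))).1
    have h2 : ((ℑ X : Matrix ℓ ℓ ℂ) i i).re = (X i i).im := by
      rw [imaginaryPart_matrix]
      simp
      ring
    have h3 : ((Xᴴ * X) i i).re = ∑ k, ‖X k i‖ ^ 2 := by
      rw [Matrix.mul_apply, Complex.re_sum]
      refine Finset.sum_congr rfl fun k _ => ?_
      rw [conjTranspose_apply, ← Complex.normSq_eq_norm_sq, Complex.normSq_apply]
      simp
    rw [Matrix.sub_apply, Complex.sub_re, h2, Matrix.smul_apply, Complex.real_smul,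
      Complex.re_ofReal_mul, h3] at h1
    linarith
  -- The case `k = i` bounds the diagonal by `1 / z.im`, and the diagonal then bounds every entry.
  have hone : ∀ k i, z.im * ‖X k i‖ ^ 2 ≤ ‖X i i‖ := by
    intro k i
    have h1 : ‖X k i‖ ^ 2 ≤ ∑ k, ‖X k i‖ ^ 2 :=
      Finset.single_le_sum (f := fun k => ‖X k i‖ ^ 2) (fun _ _ => by positivity)
        (Finset.mem_univ k)
    have h2 := (le_abs_self _).trans (Complex.abs_im_le_norm (X i i))
    nlinarith [hentry i]
  have hdiag : ∀ i, ‖X i i‖ ≤ 1 / z.im := by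
    intro i
    have h1 := hone i i
    rw [le_div_iff₀ hz]
    by_contra hlt
    have h2 : 0 < ‖X i i‖ := by
      rcases (norm_nonneg (X i i)).eq_or_lt with h0 | h0
      · rw [← h0] at hlt; simp at hlt
      · exact h0
    nlinarith
  have hall : ∀ k i, ‖X k i‖ ≤ 1 / z.im := by
    intro k i
    have h1 : z.im * ‖X k i‖ ^ 2 ≤ 1 / z.im := (hone k i).trans (hdiag i)
    refine le_of_sq_le_sq ?_ (by positivity)
    rw [le_div_iff₀ hz] at h1
    rw [div_pow, le_div_iff₀ (by positivity)]
    linarith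
  refine (norm_le_sum_entries X).trans ?_
  calc ∑ i, ∑ j, ‖X i j‖ ≤ ∑ i : ℓ, ∑ j : ℓ, 1 / z.im :=
        Finset.sum_le_sum fun i _ => Finset.sum_le_sum fun j _ => hall i j
    _ = _ := by simp; ring

/-- Far up in the half-plane the Dyson equation has at most one solution with positive imaginary
part. -/
theorem DysonData.unique_of_im_large {p : Matrix ℓ ℓ ℂ} (D : DysonData p H J S)
    (hp : p.IsHermitian) (hH : H.IsHermitian) (hS : ∀ W, W.PosSemidef → (S W).PosSemidef) :
    ∃ y₀ : ℝ, 0 < y₀ ∧ ∀ z : ℂ, y₀ ≤ z.im → ∀ G G' : Matrix ℓ ℓ ℂ,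
      (H - S G - z • p) * G = 1 → (ℑ G : Matrix ℓ ℓ ℂ).PosSemidef →
      (H - S G' - z • p) * G' = 1 → (ℑ G' : Matrix ℓ ℓ ℂ).PosSemidef → G = G' := by
  obtain ⟨c, hc0, hc⟩ := (LinearMap.toContinuousLinearMap S).bound
  obtain ⟨ε, K, R, δ, τ, hε, hK, hR, hδ, hτ, -, hsmall, hcontr⟩ := D.exists_constants hc hc0.le
  -- From this height on the corner of any solution with positive semidefinite imaginary part is at
  -- most `δ`; the `+ 1` ensures positivity when `ℓ` is empty.
  refine ⟨(Fintype.card ℓ : ℝ) ^ 2 / δ + 1, by positivity, fun z hz G G' h1 h2 h3 h4 => ?_⟩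
  have hz0 : 0 < z.im := lt_of_lt_of_le (by positivity) hz
  have hle : (Fintype.card ℓ : ℝ) ^ 2 / z.im ≤ δ := by
    rw [div_le_iff₀ hz0]
    have h5 : (Fintype.card ℓ : ℝ) ^ 2 / δ ≤ z.im := by linarith
    rw [div_le_iff₀ hδ] at h5
    linarith
  have hsm : ∀ G : Matrix ℓ ℓ ℂ, (H - S G - z • p) * G = 1 →
      (ℑ G : Matrix ℓ ℓ ℂ).PosSemidef → IsSmall p ε K G := fun G hG1 hG2 =>
    hsmall G z ((norm_corner_le_of_dyson hp D.idem hH hS hz0 hG1 hG2).trans hle) hG1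
      (mul_eq_one_comm.1 hG1)
  have hdiff : G - G' = G * S (G - G') * G' := by
    have h5 : S (G - G') = (H - S G' - z • p) - (H - S G - z • p) := by
      rw [map_sub]; abel
    rw [h5, mul_sub, sub_mul, mul_eq_one_comm.1 h1, one_mul, mul_assoc, h3, mul_one]
  have h6 := hcontr G G' (G - G') (hsm G h1 h2) (hsm G' h3 h4)
  rw [← hdiff] at h6
  have h7 : 0 ≤ τ * ‖p * (G - G') * p‖ := by positivity
  have h8 : ‖G - G'‖ ≤ 0 := by linarith
  exact sub_eq_zero.1 (norm_le_zero_iff.1 h8)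

end AbstractDyson

/-! ### The random matrix data: complexification, expectations and the superoperator -/

namespace DEL

section Complexification

open Matrix

variable {a b c : Type*}

theorem toC_mul [Fintype b] (X : Matrix a b ℝ) (Y : Matrix b c ℝ) :
    toC (X * Y) = toC X * toC Y :=
  Matrix.map_mul (f := Complex.ofRealHom)

theorem toC_sub (X Y : Matrix a b ℝ) : toC (X - Y) = toC X - toC Y := by
  ext; simp [toC]

theorem toC_neg (X : Matrix a b ℝ) : toC (-X) = -toC X := by
  ext; simp [toC]

theorem toC_one [DecidableEq a] : toC (1 : Matrix a a ℝ) = 1 :=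
  Matrix.map_one _ Complex.ofReal_zero Complex.ofReal_one

theorem toC_conjTranspose (X : Matrix a b ℝ) : (toC X)ᴴ = toC Xᵀ := by
  ext; simp [toC]

theorem toC_fromBlocks {d : Type*} (X : Matrix a b ℝ) (Y : Matrix a c ℝ) (Z : Matrix d b ℝ)
    (W : Matrix d c ℝ) :
    toC (fromBlocks X Y Z W) = fromBlocks (toC X) (toC Y) (toC Z) (toC W) :=
  Matrix.fromBlocks_map ..

end Complexification

section Expectation

open Matrix

variable {Ω : Type*} [MeasurableSpace Ω] {P : Measure Ω} {a b k l : Type*}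
  [Fintype k] [Fintype l] {U : Ω → Matrix a k ℝ} {V : Ω → Matrix l b ℝ}

theorem toC_mul_mul_toC_apply (X : Matrix a k ℝ) (W : Matrix k l ℂ) (Y : Matrix l b ℝ) (i : a)
    (j : b) : (toC X * W * toC Y) i j = ∑ y, ∑ x, W x y * ((X i x * Y y j : ℝ) : ℂ) := by
  simp only [Matrix.mul_apply, Finset.sum_mul, toC, Matrix.map_apply, Complex.ofReal_mul]
  exact Finset.sum_congr rfl fun y _ => Finset.sum_congr rfl fun x _ => by ring

/-- A finite combination of scalar moments with coefficients from `W`, whence linearity in `W`. -/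
theorem expect_toC_mul_mul_toC_apply
    (h : ∀ i x y j, Integrable (fun ω => U ω i x * V ω y j) P) (W : Matrix k l ℂ) (i : a) (j : b) :
    expect P (fun ω => toC (U ω) * W * toC (V ω)) i j =
      ∑ y, ∑ x, W x y * ((∫ ω, U ω i x * V ω y j ∂P : ℝ) : ℂ) := by
  have hint : ∀ x y, Integrable (fun ω => W x y * ((U ω i x * V ω y j : ℝ) : ℂ)) P :=
    fun x y => (h i x y j).ofReal.const_mul _
  simp only [expect, Matrix.of_apply, toC_mul_mul_toC_apply]
  rw [integral_finsetSum _ fun y _ => integrable_finsetSum _ fun x _ => hint x y]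
  refine Finset.sum_congr rfl fun y _ => ?_
  rw [integral_finsetSum _ fun x _ => hint x y]
  refine Finset.sum_congr rfl fun x _ => ?_
  rw [integral_const_mul, integral_complex_ofReal]

theorem expect_toC_mul_mul_toC_add
    (h : ∀ i x y j, Integrable (fun ω => U ω i x * V ω y j) P) (W W' : Matrix k l ℂ) :
    expect P (fun ω => toC (U ω) * (W + W') * toC (V ω)) =
      expect P (fun ω => toC (U ω) * W * toC (V ω)) +
        expect P (fun ω => toC (U ω) * W' * toC (V ω)) := by
  ext i j
  simp only [Matrix.add_apply, expect_toC_mul_mul_toC_apply h, add_mul, Finset.sum_add_distrib]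

theorem expect_toC_mul_mul_toC_smul
    (h : ∀ i x y j, Integrable (fun ω => U ω i x * V ω y j) P) (r : ℂ) (W : Matrix k l ℂ) :
    expect P (fun ω => toC (U ω) * (r • W) * toC (V ω)) =
      r • expect P (fun ω => toC (U ω) * W * toC (V ω)) := by
  ext i j
  simp only [Matrix.smul_apply, expect_toC_mul_mul_toC_apply h, Finset.mul_sum, smul_eq_mul,
    mul_assoc]

theorem expect_isSymm {X : Ω → Matrix a a ℝ} (h : ∀ᵐ ω ∂P, (X ω).IsSymm) :
    (expect P X).IsSymm := by
  ext i j
  simp only [Matrix.transpose_apply, expect, Matrix.of_apply]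
  exact integral_congr_ae (h.mono fun ω hω => hω.apply i j)

theorem expect_linearization {n d : ℕ} (A : Ω → Matrix (Fin n) (Fin n) ℝ)
    (B : Ω → Matrix (Fin d) (Fin n) ℝ) (Q : Ω → Matrix (Fin d) (Fin d) ℝ) :
    expect P (fun ω => linearization (A ω) (B ω) (Q ω)) =
      linearization (expect P A) (expect P B) (expect P Q) := by
  ext (i | i) (j | j) <;> rfl

variable [IsProbabilityMeasure P]

theorem integrable_centered_mul {f g : Ω → ℝ} (hf : Integrable f P) (hg : Integrable g P)
    (hfg : Integrable (fun ω => f ω * g ω) P) (x y : ℝ) :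
    Integrable (fun ω => (f ω - x) * (g ω - y)) P := by
  have h : (fun ω => (f ω - x) * (g ω - y)) =
      fun ω => f ω * g ω - x * g ω - y * f ω + x * y := by
    funext ω; ring
  rw [h]
  exact ((hfg.sub (hg.const_mul x)).sub (hf.const_mul y)).add (integrable_const _)

theorem integral_centered_mul {f g : Ω → ℝ} (hf : Integrable f P) (hg : Integrable g P)
    (hfg : Integrable (fun ω => f ω * g ω) P) :
    ∫ ω, (f ω - ∫ ω, f ω ∂P) * (g ω - ∫ ω, g ω ∂P) ∂P =
      (∫ ω, f ω * g ω ∂P) - (∫ ω, f ω ∂P) * ∫ ω, g ω ∂P := by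
  generalize hx : ∫ ω, f ω ∂P = x
  generalize hy : ∫ ω, g ω ∂P = y
  have h : (fun ω => (f ω - x) * (g ω - y)) =
      fun ω => f ω * g ω - x * g ω - y * f ω + x * y := by
    funext ω; ring
  have h1 : Integrable (fun ω => f ω * g ω - x * g ω) P := hfg.sub (hg.const_mul x)
  have h2 : Integrable (fun ω => f ω * g ω - x * g ω - y * f ω) P := h1.sub (hf.const_mul y)
  rw [h, integral_add h2 (integrable_const _), integral_sub h1 (hf.const_mul y),
    integral_sub hfg (hg.const_mul x), integral_const_mul, integral_const_mul, hx, hy]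
  simp
  ring

/-- The covariance identity `E[(B - EB)(B - EB)ᵀ] = E[B Bᵀ] - E[B] E[B]ᵀ`. -/
theorem expect_centered_mul_transpose {c : Type*} [Fintype c] [DecidableEq c]
    {B : Ω → Matrix b c ℝ} (hB : ∀ i j, MemLp (fun ω => B ω i j) 2 P) :
    expect P (fun ω => toC (B ω - expect P B) * (1 : Matrix c c ℂ) * toC (B ω - expect P B)ᵀ) =
      toC (expect P (fun ω => B ω * (B ω)ᵀ) - expect P B * (expect P B)ᵀ) := by
  have hB1 : ∀ i j, Integrable (fun ω => B ω i j) P := fun i j =>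
    (hB i j).integrable one_le_two
  have hBB : ∀ i j i' j', Integrable (fun ω => B ω i j * B ω i' j') P := fun i j i' j' =>
    (hB i j).integrable_mul (hB i' j')
  ext i j
  have hint : ∀ i x y j, Integrable
      (fun ω => (B ω - expect P B) i x * (B ω - expect P B)ᵀ y j) P := fun i x y j =>
    integrable_centered_mul (hB1 i x) (hB1 j y) (hBB i x j y) _ _
  rw [expect_toC_mul_mul_toC_apply hint]
  have h : ∀ x, ∫ ω, (B ω - expect P B) i x * (B ω - expect P B)ᵀ x j ∂P =
      (∫ ω, B ω i x * B ω j x ∂P) - expect P B i x * expect P B j x := fun x =>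
    integral_centered_mul (hB1 i x) (hB1 j x) (hBB i x j x)
  simp only [Matrix.one_apply, ite_mul, one_mul, zero_mul, Finset.sum_ite_eq', Finset.mem_univ,
    if_true, h]
  simp only [toC, Matrix.map_apply, Matrix.sub_apply, expect, Matrix.of_apply, Matrix.mul_apply,
    Matrix.transpose_apply]
  rw [integral_finsetSum _ fun x _ => hBB i x j x, ← Finset.sum_sub_distrib, Complex.ofReal_sum]

end Expectation

section Superoperator

open Matrix
open scoped Matrix.Norms.Operator

variable {n d : ℕ} {Ω : Type*} [MeasurableSpace Ω] {P : Measure Ω}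
  {A : Ω → Matrix (Fin n) (Fin n) ℝ} {B : Ω → Matrix (Fin d) (Fin n) ℝ}
  {Q : Ω → Matrix (Fin d) (Fin d) ℝ}

theorem exists_superop_linearMap [IsProbabilityMeasure P]
    (hA : ∀ i j, Integrable (fun ω => A ω i j) P)
    (hB : ∀ i j, MemLp (fun ω => B ω i j) 2 P)
    (hAB : ∀ i j k l, Integrable (fun ω => A ω i j * B ω k l) P)
    (S₁₁ : BlockMat n d →ₗ[ℂ] Matrix (Fin n) (Fin n) ℂ) :
    ∃ S : BlockMat n d →ₗ[ℂ] BlockMat n d, ∀ W, S W = superop P A B S₁₁ W := by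
  have hB1 : ∀ i j, Integrable (fun ω => B ω i j) P := fun i j =>
    (hB i j).integrable one_le_two
  have h12 : ∀ i x y j, Integrable
      (fun ω => (A ω - expect P A) i x * (B ω - expect P B)ᵀ y j) P := fun i x y j =>
    integrable_centered_mul (hA i x) (hB1 j y) (hAB i x j y) _ _
  have h21 : ∀ i x y j, Integrable
      (fun ω => (B ω - expect P B) i x * (A ω - expect P A) y j) P := fun i x y j =>
    integrable_centered_mul (hB1 i x) (hA y j) (by simpa only [mul_comm] using hAB y j i x) _ _
  have h22 : ∀ i x y j, Integrable
      (fun ω => (B ω - expect P B) i x * (B ω - expect P B)ᵀ y j) P := fun i x y j =>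
    integrable_centered_mul (hB1 i x) (hB1 j y) ((hB i x).integrable_mul (hB j y)) _ _
  refine ⟨⟨⟨superop P A B S₁₁, fun W W' => ?_⟩, fun r W => ?_⟩, fun W => rfl⟩
  · have h : (W + W').toBlocks₁₁ = W.toBlocks₁₁ + W'.toBlocks₁₁ := rfl
    simp only [superop, h, map_add, expect_toC_mul_mul_toC_add h12,
      expect_toC_mul_mul_toC_add h21, expect_toC_mul_mul_toC_add h22, fromBlocks_add]
  · have h : (r • W).toBlocks₁₁ = r • W.toBlocks₁₁ := rfl
    simp only [superop, h, map_smul, expect_toC_mul_mul_toC_smul h12,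
      expect_toC_mul_mul_toC_smul h21, expect_toC_mul_mul_toC_smul h22, fromBlocks_smul,
      RingHom.id_apply]

theorem one_sub_Lam (n d : ℕ) : 1 - Lam n d = fromBlocks 0 0 0 1 := by
  rw [Lam, ← fromBlocks_one, sub_eq_add_neg, fromBlocks_neg, fromBlocks_add]
  simp

theorem Lam_eq_diagonal (n d : ℕ) :
    Lam n d = diagonal (Sum.elim (fun _ => 1) fun _ => 0) := by
  rw [Lam, ← diagonal_one, ← diagonal_zero, fromBlocks_diagonal]

theorem one_sub_Lam_eq_diagonal (n d : ℕ) :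
    1 - Lam n d = diagonal (Sum.elim (fun _ => 0) fun _ => 1) := by
  rw [one_sub_Lam, ← diagonal_one, ← diagonal_zero, fromBlocks_diagonal]

theorem isHermitian_Lam (n d : ℕ) : (Lam n d).IsHermitian := by
  simp [Lam, IsHermitian, fromBlocks_conjTranspose]

theorem toC_nonsing_inv_mul (h : IsUnit (expect P Q)) :
    toC (expect P Q)⁻¹ * toC (expect P Q) = 1 := by
  rw [← toC_mul, nonsing_inv_mul _ ((isUnit_iff_isUnit_det _).1 h), toC_one]

theorem toC_mul_nonsing_inv (h : IsUnit (expect P Q)) :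
    toC (expect P Q) * toC (expect P Q)⁻¹ = 1 := by
  rw [← toC_mul, mul_nonsing_inv _ ((isUnit_iff_isUnit_det _).1 h), toC_one]

theorem toC_linearization (X : Matrix (Fin n) (Fin n) ℝ) (Y : Matrix (Fin d) (Fin n) ℝ)
    (Z : Matrix (Fin d) (Fin d) ℝ) :
    toC (linearization X Y Z) = fromBlocks (toC X) (toC Yᵀ) (toC Y) (toC Z) :=
  toC_fromBlocks ..

/-- The corner properties hold because three blocks of the superoperator involve only `W₁₁`; the
given map `S₁₁` sits in the block that `1 - Λ` removes. -/
theorem dysonData_superop (hQ : IsUnit (expect P Q))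
    {S₁₁ : BlockMat n d →ₗ[ℂ] Matrix (Fin n) (Fin n) ℂ} {S : BlockMat n d →ₗ[ℂ] BlockMat n d}
    (hS : ∀ W, S W = superop P A B S₁₁ W) :
    DysonData (Lam n d) (toC (linearization (expect P A) (expect P B) (expect P Q)))
      (MInfty P Q n) S where
  idem := by simp [Lam, fromBlocks_multiply]
  norm_p := by
    rw [Lam_eq_diagonal, linfty_opNorm_diagonal, pi_norm_le_iff_of_nonneg zero_le_one]
    rintro (i | i) <;> simp
  norm_q := by
    rw [one_sub_Lam_eq_diagonal, linfty_opNorm_diagonal, pi_norm_le_iff_of_nonneg zero_le_one]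
    rintro (i | i) <;> simp
  p_mul_J := by simp [Lam, MInfty, fromBlocks_multiply]
  J_mul_p := by simp [Lam, MInfty, fromBlocks_multiply]
  J_mul_H := by
    simp [one_sub_Lam, MInfty, toC_linearization, fromBlocks_multiply, toC_nonsing_inv_mul hQ]
  H_mul_J := by
    simp [one_sub_Lam, MInfty, toC_linearization, fromBlocks_multiply, toC_mul_nonsing_inv hQ]
  left_corner W := by
    obtain ⟨W₁, W₂, W₃, W₄, rfl⟩ : ∃ a b c d, W = fromBlocks a b c d :=
      ⟨_, _, _, _, (fromBlocks_toBlocks W).symm⟩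
    rw [one_sub_Lam]
    simp [hS, superop, Lam, fromBlocks_multiply]
  right_corner W := by
    obtain ⟨W₁, W₂, W₃, W₄, rfl⟩ : ∃ a b c d, W = fromBlocks a b c d :=
      ⟨_, _, _, _, (fromBlocks_toBlocks W).symm⟩
    rw [one_sub_Lam]
    simp [hS, superop, Lam, fromBlocks_multiply]

theorem dysonMass_superop [IsProbabilityMeasure P] (hB : ∀ i j, MemLp (fun ω => B ω i j) 2 P)
    (hQ : IsUnit (expect P Q)) {S₁₁ : BlockMat n d →ₗ[ℂ] Matrix (Fin n) (Fin n) ℂ}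
    {S : BlockMat n d →ₗ[ℂ] BlockMat n d} (hS : ∀ W, S W = superop P A B S₁₁ W) :
    dysonMass (Lam n d) (toC (linearization (expect P A) (expect P B) (expect P Q)))
      (MInfty P Q n) S = totalMass P B Q := by
  have h1 : S (Lam n d) = fromBlocks (S₁₁ (Lam n d))
      (expect P fun ω => toC (A ω - expect P A) * (1 : Matrix (Fin n) (Fin n) ℂ) * toC (B ω - expect P B).transpose)
      (expect P fun ω => toC (B ω - expect P B) * (1 : Matrix (Fin n) (Fin n) ℂ) * toC (A ω - expect P A))
      (toC (expect P (fun ω => B ω * (B ω)ᵀ) - expect P B * (expect P B)ᵀ)) := by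
    rw [hS, superop, ← expect_centered_mul_transpose hB]
    simp only [Lam, toBlocks_fromBlocks₁₁]
  unfold dysonMass
  rw [h1]
  simp only [Lam, MInfty, totalMass, toC_linearization, toC_fromBlocks, fromBlocks_multiply,
    ← fromBlocks_one, sub_eq_add_neg, fromBlocks_neg, fromBlocks_add, toC_nonsing_inv_mul hQ,
    toC_mul_nonsing_inv hQ, toC_one, toC_neg, toC_mul]
  simp only [← sub_eq_add_neg, toC_sub, toC_mul, Matrix.mul_zero, Matrix.zero_mul, add_zero,
    zero_add, neg_zero, Matrix.mul_one, Matrix.one_mul, zero_sub, sub_self,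
    Matrix.mul_neg, Matrix.neg_mul, neg_neg, Matrix.mul_sub, Matrix.sub_mul, Matrix.mul_assoc]
  -- In the lower right block the term `-E[B] E[B]ᵀ` of the covariance cancels the contribution of
  -- `(1 - J H) Λ (1 - H J)`.
  congr 1
  abel

theorem isHermitian_toC_linearization {X : Matrix (Fin n) (Fin n) ℝ} (hX : X.IsSymm)
    (Y : Matrix (Fin d) (Fin n) ℝ) {Z : Matrix (Fin d) (Fin d) ℝ} (hZ : Z.IsSymm) :
    (toC (linearization X Y Z)).IsHermitian := by
  rw [IsHermitian, toC_conjTranspose, linearization, fromBlocks_transpose, hX.eq, hZ.eq,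
    transpose_transpose]

theorem isHermitian_MInfty (hQ : (expect P Q).IsSymm) : (MInfty P Q n).IsHermitian := by
  rw [IsHermitian, MInfty, fromBlocks_conjTranspose, toC_conjTranspose, transpose_nonsing_inv,
    hQ.eq]
  simp

end Superoperator

/-! ### Admissibility and the identity theorem -/

section Solution

open Matrix

variable {n d : ℕ}

theorem imaginaryPart_toBlocks₁₁ (W : BlockMat n d) :
    (ℑ W.toBlocks₁₁ : Matrix (Fin n) (Fin n) ℂ) = (ℑ W : BlockMat n d).toBlocks₁₁ := by
  rw [imaginaryPart_matrix, imaginaryPart_matrix]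
  rfl

/-- A matrix whose imaginary part dominates a positive multiple of a positive semidefinite matrix
with upper left block `1` is admissible. -/
theorem mem_admissibleSet {W T : BlockMat n d} (hT : T.PosSemidef) (hT₁ : T.toBlocks₁₁ = 1)
    {c : ℝ} (hc : 0 < c) (hW : ((ℑ W : BlockMat n d) - c • T).PosSemidef) :
    W ∈ admissibleSet n d := by
  have h1 : (ℑ W : BlockMat n d) = ((ℑ W : BlockMat n d) - c • T) + c • T := by abel
  refine ⟨?_, ?_⟩
  · rw [h1]
    exact hW.add (hT.smul hc.le)
  · rw [imaginaryPart_toBlocks₁₁]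
    have h2 : (ℑ W : BlockMat n d).toBlocks₁₁ =
        ((ℑ W : BlockMat n d) - c • T).submatrix Sum.inl Sum.inl +
          c • (1 : Matrix (Fin n) (Fin n) ℂ) := by
      rw [← hT₁]
      nth_rw 1 [h1]
      rfl
    rw [h2]
    exact PosDef.posSemidef_add (hW.submatrix _) (PosDef.one.smul hc)

theorem isOpen_upperHalf : IsOpen upperHalf :=
  isOpen_lt continuous_const Complex.continuous_im

/-- Holomorphic functions on the upper half-plane that agree far up agree everywhere. -/
theorem eqOn_upperHalf_of_im_large {f g : ℂ → ℂ} (hf : DifferentiableOn ℂ f upperHalf)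
    (hg : DifferentiableOn ℂ g upperHalf) {y : ℝ} (hy : 0 < y)
    (h : ∀ z : ℂ, y ≤ z.im → f z = g z) : Set.EqOn f g upperHalf := by
  refine (hf.analyticOnNhd isOpen_upperHalf).eqOn_of_preconnected_of_eventuallyEq
    (hg.analyticOnNhd isOpen_upperHalf) (convex_halfSpace_im_gt 0).isPreconnected
    (z₀ := ⟨0, y + 1⟩) (show (0 : ℝ) < y + 1 by linarith) ?_
  have h1 : {z : ℂ | y < z.im} ∈ nhds (⟨0, y + 1⟩ : ℂ) :=
    (isOpen_lt continuous_const Complex.continuous_im).mem_nhds (show y < y + 1 by linarith)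
  filter_upwards [h1] with z hz using h z (le_of_lt hz)

theorem fromCols_mul_conjTranspose :
    (fromCols 1 0 : Matrix (Fin n) (Fin n ⊕ Fin d) ℂ) *
      (fromCols 1 0 : Matrix (Fin n) (Fin n ⊕ Fin d) ℂ)ᴴ = 1 := by
  rw [conjTranspose_fromCols_eq_fromRows_conjTranspose, fromCols_mul_fromRows]
  simp

theorem conjTranspose_mul_fromCols :
    (fromCols 1 0 : Matrix (Fin n) (Fin n ⊕ Fin d) ℂ)ᴴ *
      (fromCols 1 0 : Matrix (Fin n) (Fin n ⊕ Fin d) ℂ) = Lam n d := by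
  rw [conjTranspose_fromCols_eq_fromRows_conjTranspose, fromRows_mul_fromCols]
  simp [Lam]

end Solution

end DEL

/-! ### The main theorem -/

theorem theorem2p1 {n d : ℕ} {Ω : Type*} [MeasurableSpace Ω] (P : Measure Ω)
    [IsProbabilityMeasure P]
    (A : Ω → Matrix (Fin n) (Fin n) ℝ) (B : Ω → Matrix (Fin d) (Fin n) ℝ)
    (Q : Ω → Matrix (Fin d) (Fin d) ℝ)
    -- `A` and `Q` are symmetric, `Q` and `E Q` are non-singular
    (hA_symm : ∀ᵐ ω ∂P, (A ω).IsSymm)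
    (hQ_symm : ∀ᵐ ω ∂P, (Q ω).IsSymm)
    (hQ_inv : ∀ᵐ ω ∂P, IsUnit (Q ω))
    (hEQ_inv : IsUnit (DEL.expect P Q))
    -- the expectations in the equation and in the total mass exist
    (hA_int : ∀ i j, Integrable (fun ω => A ω i j) P)
    (hQ_int : ∀ i j, Integrable (fun ω => Q ω i j) P)
    (hB_sq : ∀ i j, MemLp (fun ω => B ω i j) 2 P)
    (hAB_int : ∀ i j k l, Integrable (fun ω => A ω i j * B ω k l) P)
    -- the superoperator is linear and positivity-preserving
    (S₁₁ : DEL.BlockMat n d →ₗ[ℂ] Matrix (Fin n) (Fin n) ℂ)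
    (hS_pos : ∀ W : DEL.BlockMat n d, W.PosSemidef → (DEL.superop P A B S₁₁ W).PosSemidef) :
    ∃ M : ℂ → DEL.BlockMat n d,
      DEL.IsSolution P A B Q S₁₁ M ∧
      (∀ M' : ℂ → DEL.BlockMat n d, DEL.IsSolution P A B Q S₁₁ M' →
        Set.EqOn M' M DEL.upperHalf) ∧
      ∃ Ξ : VectorMeasure ℝ (DEL.BlockMat n d),
        DEL.IsPSDMeasure Ξ ∧
        DEL.IsCompactlySupported Ξ ∧
        (∀ z ∈ DEL.upperHalf,
          DEL.HasMatIntegral Ξ (fun x : ℝ => ((x : ℂ) - z)⁻¹) (M z - DEL.MInfty P Q n)) ∧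
        Ξ Set.univ = DEL.totalMass P B Q := by
  obtain ⟨S, hS⟩ := DEL.exists_superop_linearMap hA_int hB_sq hAB_int S₁₁
  have hpos : ∀ W, W.PosSemidef → (S W).PosSemidef := fun W hW => by
    rw [hS]; exact hS_pos W hW
  have hQs := DEL.expect_isSymm hQ_symm
  have hH := DEL.isHermitian_toC_linearization (DEL.expect_isSymm hA_symm) (DEL.expect P B) hQs
  have hmass := DEL.dysonMass_superop (A := A) hB_sq hEQ_inv hS
  have D := DEL.dysonData_superop hEQ_inv hS
  obtain ⟨y, hy, huniq⟩ := D.unique_of_im_large (DEL.isHermitian_Lam n d) hH hpos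
  -- The realization needs the projection factored as `eᴴ e` with `e eᴴ = 1`.
  rw [← DEL.conjTranspose_mul_fromCols] at D
  obtain ⟨M, R, L, hL, hL1, hM, hdiff, hrep, him⟩ := D.exists_solution
    DEL.fromCols_mul_conjTranspose hH (DEL.isHermitian_MInfty hQs) hpos
  rw [DEL.conjTranspose_mul_fromCols] at *
  rw [hmass] at hL1
  simp only [hmass] at him
  have hT : (DEL.totalMass P B Q).PosSemidef := hL1 ▸ hL 1 fun _ => zero_le_one
  have hT₁ : (DEL.totalMass P B Q).toBlocks₁₁ = 1 := by
    rw [DEL.totalMass, DEL.toC_fromBlocks, Matrix.toBlocks_fromBlocks₁₁, DEL.toC_one]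
  have hsol : DEL.IsSolution P A B Q S₁₁ M :=
    { holomorphic := fun i j z hz => (hdiff z (ne_of_gt hz) i j).differentiableWithinAt
      admissible := fun z hz =>
        let ⟨c, hc, hcT⟩ := him z hz
        DEL.mem_admissibleSet hT hT₁ hc hcT
      dyson := fun z hz => by
        rw [DEL.expect_linearization, ← hS]
        exact hM z (ne_of_gt hz) }
  refine ⟨M, hsol, fun M' hM' => ?_, ?_⟩
  · have hdyson : ∀ N, DEL.IsSolution P A B Q S₁₁ N → ∀ z ∈ DEL.upperHalf,
        (DEL.toC (DEL.linearization (DEL.expect P A) (DEL.expect P B) (DEL.expect P Q)) -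
          S (N z) - z • DEL.Lam n d) * N z = 1 := fun N hN z hz => by
      rw [hS, ← DEL.expect_linearization]
      exact hN.dyson z hz
    have hfar : ∀ z : ℂ, y ≤ z.im → M' z = M z := fun z hz =>
      have hz0 : z ∈ DEL.upperHalf := hy.trans_le hz
      huniq z hz _ _ (hdyson M' hM' z hz0) (hM'.admissible z hz0).1 (hdyson M hsol z hz0)
        (hsol.admissible z hz0).1
    intro z hz
    ext i j
    exact DEL.eqOn_upperHalf_of_im_large (hM'.holomorphic i j) (hsol.holomorphic i j) hy
      (fun w hw => by rw [hfar w hw]) hz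
  · obtain ⟨Ξ, hΞ, hcpt, huniv, hint⟩ := exists_vectorMeasure_of_positive L hL
    refine ⟨Ξ, hΞ, hcpt, fun z hz => ?_, huniv.trans hL1⟩
    have hker : Continuous fun x : ℝ => ((x : ℂ) - z)⁻¹ :=
      (Complex.continuous_ofReal.sub continuous_const).inv₀
        fun x => ofReal_sub_ne_zero (ne_of_gt hz) x
    -- The functional `L` acts on real functions, so the kernel is split into real and imaginary
    -- parts.
    let f : C(ℝ, ℝ) := ⟨fun x => ((x : ℂ) - z)⁻¹.re, Complex.continuous_re.comp hker⟩
    let g : C(ℝ, ℝ) := ⟨fun x => ((x : ℂ) - z)⁻¹.im, Complex.continuous_im.comp hker⟩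
    have hfg : ∀ x, (f x : ℂ) + g x * Complex.I = ((x : ℂ) - z)⁻¹ := fun x =>
      Complex.re_add_im _
    have h := hint f g
    rw [← hrep z (ne_of_gt hz) f g hfg] at h
    simpa only [hfg] using h
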